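/- Let $\sigma$ be a countable relational signature with only finitely many symbols of arity at least $2$. A \emph{structure} is a finite $\sigma$-structure $\mathbf A$ with domain $A$, endowed with a probability measure $\nu_{\mathbf A}$ on $A$. Distances in $\mathbf A$ are graph distances in its Gaifman graph; for $X\subseteq A$, $N^d_{\mathbf A}(X)$ is the set of elements at distance at most $d$ from an element of $X$, and $\partial_{\mathbf A}X=N^1_{\mathbf A}(X)\setminus X$. A first-order formula $\phi(x_1,\dots,x_p)$ is \emph{local} if for some $r$, in every finite structure, its satisfaction by $(v_1,\dots,v_p)$ is equivalent to its satisfaction by $(v_1,\dots,v_p)$ in the substructure induced by $N^r_{\mathbf A}(\{v_1,\dots,v_p\})$. A sequence $(\mathbf A_n)_{n\in\mathbb N}$ of structures is \emph{local convergent} if for every local formula $\phi$ the probability $\langle\phi,\mathbf A_n\rangle$ that $\phi$ is satisfied in $\mathbf A_n$ by independent $\nu_{\mathbf A_n}$-random elements converges as $n\to\infty$. Let $(\mathbf A_n)$ be local convergent. For $d,n\in\mathbb N$ let $D_{d,n}(v)=\nu_{\mathbf A_n}(N^d_{\mathbf A_n}(\{v\}))$, where $v\in A_n$ is $\nu_{\mathbf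 A_n}$-random. Then $D_{d,n}$ converges in distribution to some random variable $D_d$ as $n\to\infty$, and $D_d$ converges in distribution to some $D$ as $d\to\infty$; the law of $D$ is the \emph{spectrum distribution}. Let $F$ be the cumulative distribution function of $D$ and $p(x)=F(x)-\lim_{\epsilon\to0^+}F(x-\epsilon)$. A sequence $(X_n)$ with $X_n\subseteq A_n$ is \emph{negligible} if $\lim_n\nu_{\mathbf A_n}(N^d_{\mathbf A_n}(X_n))=0$ for every $d$. It is a \emph{cluster} if $(\partial_{\mathbf A_n}X_n)$ is negligible and the sequence obtained from $(\mathbf A_n)$ by marking $X_n$ with a new unary relation is local convergent. A \emph{globular cluster} is a non-negligible cluster such that for every $\epsilon>0$ there is $d$ with $\liminf_{n}\max_{v\in X_n}\nu_{\mathbf A_n[X_n]}(N^d_{\mathbf A_n[X_n]}(\{v\}))>1-\epsilon$, where $\mathbf A_n[X_n]$ is the induced substructure with the normalized measure. \textbf{Statement.} For every discontinuity point $\lambda>0$ of $F$ (that is, every positive atom of the spectrum distribution), $m=p(\lambda)/\lambda$ is a positive integer. Moreover $m$ is the number of disjoint globular clusters with limit measure $\lambda$: there exist $m$ pairwise disjoint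 globular clusters $(G^1_n),\dots,(G^m_n)$ with $\lim_n\nu_{\mathbf A_n}(G^i_n)=\lambda$ for every $i$, and any finite family of globular clusters with limit measure $\lambda$ whose pairwise intersections are negligible has at most $m$ members. -/

import Mathlib

open FirstOrder Filter Topology MeasureTheory

universe u v

noncomputable section

namespace StructLim

/-! ### Gaifman graph, closed neighbourhoods, induced substructures -/

/-- The Gaifman graph: two distinct elements are adjacent if they occur together in a tuple
of some relation. -/
def gaifman (L : FirstOrder.Language.{u, v}) (M : Type) [L.Structure M] : SimpleGraph M where
  Adj a b := a ≠ b ∧ ∃ (n : ℕ) (R : L.Relations n) (x : Fin n → M),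
    FirstOrder.Language.Structure.RelMap R x ∧ a ∈ Set.range x ∧ b ∈ Set.range x
  symm := ⟨fun _ _ ⟨h, n, R, x, hx, ha, hb⟩ => ⟨h.symm, n, R, x, hx, hb, ha⟩⟩
  loopless := ⟨fun _ h => h.1 rfl⟩

/-- The set of elements at distance at most `d` from an element of `X`
(elements of other connected components are at distance `⊤`). -/
def nbhd (L : FirstOrder.Language.{u, v}) {M : Type} [L.Structure M] (d : ℕ) (X : Set M) : Set M :=
  {b | ∃ a ∈ X, (gaifman L M).edist a b ≤ d}

theorem subset_nbhd (L : FirstOrder.Language.{u, v}) {M : Type} [L.Structure M] (d : ℕ) (X : Set M) :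
    X ⊆ nbhd L d X := fun a ha => ⟨a, ha, by simp⟩

/-- The outer boundary of `X`. -/
def outerBoundary (L : FirstOrder.Language.{u, v}) {M : Type} [L.Structure M] (X : Set M) : Set M :=
  nbhd L 1 X \ X

/-- The substructure induced by a set of elements; the signature is relational. -/
def inducedOn (L : FirstOrder.Language.{u, v}) [L.IsRelational] {M : Type} [L.Structure M] (X : Set M) :
    L.Substructure M where
  carrier := X
  fun_mem := fun {_} f => isEmptyElim f

/-! ### Finite structures endowed with a probability measure -/

/-- A finite `L`-structure endowed with a probability measure, given by its point masses. -/
structure FinStruct (L : FirstOrder.Language.{u, v}) where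
  carrier : Type
  [fintype : Fintype carrier]
  [str : L.Structure carrier]
  weight : carrier → ℝ
  weight_nonneg : ∀ a, 0 ≤ weight a
  weight_sum : ∑ a, weight a = 1

attribute [instance] FinStruct.fintype FinStruct.str

namespace FinStruct

variable {L : FirstOrder.Language.{u, v}}

open Classical in
/-- The measure of a set of elements. -/
def meas (A : FinStruct L) (X : Set A.carrier) : ℝ :=
  ∑ a with a ∈ X, A.weight a

open Classical in
/-- The Stone pairing: the probability that `φ` is satisfied when its free variables are assigned
independent random elements of `A`. -/
def stonePairing (A : FinStruct L) {p : ℕ} (φ : L.Formula (Fin p)) : ℝ :=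
  ∑ x : Fin p → A.carrier with φ.Realize x, ∏ i, A.weight (x i)

/-- The measure of the ball of radius `d` centred at `a`. -/
def ballMeas (A : FinStruct L) (d : ℕ) (a : A.carrier) : ℝ :=
  A.meas (nbhd L d {a})

/-- The law of the measure of the ball of radius `d` centred at a random element of `A`. -/
def ballLaw (A : FinStruct L) (d : ℕ) : ProbabilityMeasure ℝ :=
  ⟨∑ a, ENNReal.ofReal (A.weight a) • Measure.dirac (A.ballMeas d a), ⟨by
    simp only [Measure.coe_finsetSum, Finset.sum_apply, Measure.smul_apply, measure_univ,
      smul_eq_mul, mul_one]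
    rw [← ENNReal.ofReal_sum_of_nonneg (fun a _ => A.weight_nonneg a), A.weight_sum,
      ENNReal.ofReal_one]⟩⟩

open Classical in
/-- `A[X]`: the substructure induced by `X` with the normalized restricted measure. It is only
meaningful when `X` has positive measure; otherwise the value is `A` itself. -/
def restrict [L.IsRelational] (A : FinStruct L) (X : Set A.carrier) : FinStruct L :=
  if h : 0 < A.meas X then
    { carrier := inducedOn L X
      fintype := Fintype.ofFinite _
      weight := fun a => A.weight a / A.meas X
      weight_nonneg := fun a => div_nonneg (A.weight_nonneg _) h.le
      weight_sum := by
        let _ : Fintype (inducedOn L X) := Fintype.ofFinite _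
        rw [← Finset.sum_div, div_eq_one_iff_eq h.ne', meas]
        exact (Finset.sum_subtype (Finset.univ.filter (· ∈ X))
          (fun x => by simp; rfl) A.weight).symm }
  else A

end FinStruct

/-! ### Marking a set by a new unary relation -/

/-- The single unary relation symbol of the marking signature. -/
inductive MarkRel : ℕ → Type
  | mark : MarkRel 1

/-- The signature with a single symbol, which is unary. -/
def markLang : FirstOrder.Language.{0, 0} := ⟨fun _ => Empty, MarkRel⟩

instance : markLang.IsRelational := fun _ => inferInstanceAs (IsEmpty Empty)

/-- Interpretation of the mark by the set `X`. -/
abbrev markStructure {M : Type} (X : Set M) : markLang.Structure M where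
  funMap := fun {_} f => isEmptyElim f
  RelMap := fun {_} R => match R with
    | MarkRel.mark => fun x => x 0 ∈ X

/-- The lift of `A` obtained by marking the elements of `X` with a new unary relation. -/
def FinStruct.mark {L : FirstOrder.Language.{u, v}} (A : FinStruct L) (X : Set A.carrier) :
    FinStruct (L.sum markLang) where
  carrier := A.carrier
  fintype := A.fintype
  str := letI := markStructure X; inferInstance
  weight := A.weight
  weight_nonneg := A.weight_nonneg
  weight_sum := A.weight_sum

/-! ### Local formulas and local convergence -/

/-- A formula is `r`-local if its satisfaction in a (finite) structure only depends on the
substructure induced by the elements at distance at most `r` from the free variables. -/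
def IsLocalAt {L : FirstOrder.Language.{u, v}} [L.IsRelational] (r : ℕ) {p : ℕ} (φ : L.Formula (Fin p)) :
    Prop :=
  ∀ (M : Type) [Finite M] [L.Structure M] (x : Fin p → M),
    φ.Realize x ↔ φ.Realize (M := inducedOn L (nbhd L r (Set.range x)))
      (fun i => ⟨x i, subset_nbhd L r _ ⟨i, rfl⟩⟩)

/-- A formula is local if it is `r`-local for some `r`. -/
def IsLocal {L : FirstOrder.Language.{u, v}} [L.IsRelational] {p : ℕ} (φ : L.Formula (Fin p)) : Prop :=
  ∃ r, IsLocalAt r φ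

/-- A sequence of structures is local convergent if all Stone pairings with local formulas
converge. -/
def LocalConvergent {L : FirstOrder.Language.{u, v}} [L.IsRelational] (A : ℕ → FinStruct L) : Prop :=
  ∀ (p : ℕ) (φ : L.Formula (Fin p)), IsLocal φ →
    ∃ l : ℝ, Tendsto (fun n => (A n).stonePairing φ) atTop (𝓝 l)

/-! ### Globular clusters -/

section Clusters

variable {L : FirstOrder.Language.{u, v}}

/-- A sequence of subsets is negligible if the measure of each of its neighbourhoods of fixed
radius tends to zero. -/
def Negligible (A : ℕ → FinStruct L) (X : ∀ n, Set (A n).carrier) : Prop :=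
  ∀ d : ℕ, Tendsto (fun n => (A n).meas (nbhd L d (X n))) atTop (𝓝 0)

/-- A cluster: marking it preserves local convergence and its outer boundary is negligible. -/
structure IsCluster [L.IsRelational] (A : ℕ → FinStruct L) (X : ∀ n, Set (A n).carrier) :
    Prop where
  lift_convergent : LocalConvergent (fun n => (A n).mark (X n))
  boundary : Negligible A (fun n => outerBoundary L (X n))

/-- Balls of bounded radius asymptotically capture almost all of the measure. -/
def NonDispersive (A : ℕ → FinStruct L) : Prop :=
  ∀ ε : ℝ, 0 < ε → ∃ d : ℕ,
    1 - ε < liminf (fun n => ⨆ a : (A n).carrier, (A n).ballMeas d a) atTop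

/-- A globular cluster: a cluster that is not negligible and induces a non-dispersive sequence. -/
structure IsGlobular [L.IsRelational] (A : ℕ → FinStruct L) (X : ∀ n, Set (A n).carrier) :
    Prop where
  cluster : IsCluster A X
  nontrivial : ¬ Negligible A X
  nonDispersive : NonDispersive (fun n => (A n).restrict (X n))

/-- The measures of the sets `X n` tend to `x`. -/
def HasLimitMeasure (A : ℕ → FinStruct L) (X : ∀ n, Set (A n).carrier) (x : ℝ) : Prop :=
  Tendsto (fun n => (A n).meas (X n)) atTop (𝓝 x)

end Clusters

/-! ### The spectrum -/

/-- `P` is the spectrum distribution of the sequence `A`: for each radius `d` the laws of the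
measures of random `d`-balls converge weakly to some `Q d` as `n → ∞`, and `Q d` converges weakly
to `P` as `d → ∞`. -/
def IsSpectrum {L : FirstOrder.Language.{u, v}} (A : ℕ → FinStruct L) (P : ProbabilityMeasure ℝ) : Prop :=
  ∃ Q : ℕ → ProbabilityMeasure ℝ,
    (∀ d, Tendsto (fun n => (A n).ballLaw d) atTop (𝓝 (Q d))) ∧ Tendsto Q atTop (𝓝 P)

/-- The discontinuities of the cumulative distribution function of `P`. -/
def atoms (P : ProbabilityMeasure ℝ) : Set ℝ :=
  {x | ¬ ContinuousAt (ProbabilityTheory.cdf (P : Measure ℝ)) x}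

/-- The mass function `p(x) = F(x) - F(x-)`, with `F` the cumulative distribution function. -/
def massAt (P : ProbabilityMeasure ℝ) (x : ℝ) : ℝ :=
  ProbabilityTheory.cdf (P : Measure ℝ) x -
    Function.leftLim (ProbabilityTheory.cdf (P : Measure ℝ)) x

end StructLim

end

noncomputable section

namespace StructLim

open FirstOrder.Language
open scoped BoundedContinuousFunction

/-! ### Neighbourhoods -/

section Neighbourhoods

variable {L : FirstOrder.Language.{u, v}} {M N : Type} [L.Structure M] [L.Structure N]

/-! Write `p` for the mass of the atom `l`. In a globular cluster of limit measure `l`, almost every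
point has a ball of fixed large radius that fills almost all of the cluster without leaving it, so
the ball measure there is close to `l`. Clusters with negligible pairwise overlap contribute
separately to the event that the ball measure is near `l`, hence `k` of them force `k * l ≤ p`
(`mul_le_of_globularLike`).

Conversely, about `p` of the mass lies at points whose balls of large radius have measure near `l`,
and most of these balls hardly grow any more. Choosing such points greedily at large mutual distance
succeeds `m` times as soon as `(m - 1) * l < p`; their balls, with radius growing slowly along a
diagonal, have negligible boundary and are concentrated on bounded balls (`exists_globularLike`).
For `m = ⌈p / l⌉` both bounds apply, so `m * l = p`.

It remains to make the marked sequences local convergent. Marking by a ball is definable from its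
centre, so averages over a random centre of statistics of marked balls converge. Because `m * l =
p`, a bump at `l` selects only centres in the clusters, up to small mass, and these averages yield
the sum over the clusters of any local statistic (`tendsto_sum_stonePairing_mark`). Products of
Stone pairings are Stone pairings, so all power sums of the vectors of statistics converge; power
sums determine a finite family up to order, and by compactness a permutation of the clusters at each
`n` makes every statistic converge (`exists_relabelling`). -/

theorem mem_nbhd_singleton {d : ℕ} {a b : M} :
    b ∈ nbhd L d {a} ↔ (gaifman L M).edist a b ≤ d := by
  simp [nbhd]

theorem mem_nbhd_singleton_comm {d : ℕ} {a b : M} : b ∈ nbhd L d {a} ↔ a ∈ nbhd L d {b} := by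
  rw [mem_nbhd_singleton, mem_nbhd_singleton, SimpleGraph.edist_comm]

theorem mem_nbhd_iff {d : ℕ} {X : Set M} {b : M} : b ∈ nbhd L d X ↔ ∃ a ∈ X, b ∈ nbhd L d {a} := by
  simp only [mem_nbhd_singleton]; rfl

@[simp] theorem nbhd_zero (X : Set M) : nbhd L 0 X = X := by
  ext b; simp [nbhd]

theorem nbhd_mono_radius {d e : ℕ} (h : d ≤ e) (X : Set M) : nbhd L d X ⊆ nbhd L e X :=
  fun _ ⟨a, ha, hab⟩ => ⟨a, ha, hab.trans (by exact_mod_cast h)⟩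

theorem nbhd_mono {d : ℕ} {X Y : Set M} (h : X ⊆ Y) : nbhd L d X ⊆ nbhd L d Y :=
  fun _ ⟨a, ha, hab⟩ => ⟨a, h ha, hab⟩

theorem nbhd_nbhd_subset (d e : ℕ) (X : Set M) : nbhd L d (nbhd L e X) ⊆ nbhd L (e + d) X := by
  rintro c ⟨b, ⟨a, ha, hab⟩, hbc⟩
  refine ⟨a, ha, ((gaifman L M).edist_triangle (v := b)).trans ?_⟩
  push_cast
  exact add_le_add hab hbc

theorem mem_nbhd_trans {d e : ℕ} {a b c : M} (h₁ : b ∈ nbhd L d {a}) (h₂ : c ∈ nbhd L e {b}) :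
    c ∈ nbhd L (d + e) {a} :=
  nbhd_nbhd_subset e d {a} (nbhd_mono (Set.singleton_subset_iff.2 h₁) h₂)

theorem mem_nbhd_succ {d : ℕ} {X : Set M} {b : M} :
    b ∈ nbhd L (d + 1) X ↔ ∃ c ∈ nbhd L d X, c = b ∨ (gaifman L M).Adj c b := by
  constructor
  · rintro ⟨a, ha, hab⟩
    obtain ⟨w, hw⟩ := SimpleGraph.exists_walk_of_edist_ne_top
      (ne_top_of_le_ne_top (ENat.natCast_ne_top (d + 1)) hab)
    rw [← hw] at hab
    have hlen : w.length ≤ d + 1 := by exact_mod_cast hab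
    induction w using SimpleGraph.Walk.concatRec with
    | Hnil => exact ⟨_, ⟨_, ha, by simp⟩, Or.inl rfl⟩
    | Hconcat p h _ =>
      refine ⟨_, ⟨_, ha, (SimpleGraph.edist_le p).trans ?_⟩, Or.inr h⟩
      rw [SimpleGraph.Walk.length_concat] at hlen
      exact_mod_cast (by omega : p.length ≤ d)
  · rintro ⟨c, hc, rfl | h⟩
    · exact nbhd_mono_radius (Nat.le_succ d) X hc
    · refine nbhd_nbhd_subset 1 d X ⟨c, hc, ?_⟩
      rw [SimpleGraph.edist_eq_one_iff_adj.2 h]; rfl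

/-- All elements of a related tuple are within distance one of each other. -/
theorem relMap_mem_nbhd_succ {d : ℕ} {X : Set M} {c : M} (hc : c ∈ nbhd L d X) {n : ℕ}
    {R : L.Relations n} {x : Fin n → M} (hx : Structure.RelMap R x) (hcx : c ∈ Set.range x)
    (i : Fin n) : x i ∈ nbhd L (d + 1) X := by
  rw [mem_nbhd_succ]
  refine ⟨c, hc, ?_⟩
  by_cases h : c = x i
  · exact Or.inl h
  · exact Or.inr ⟨h, n, R, x, hx, hcx, i, rfl⟩

theorem image_nbhd_subset (f : N ↪[L] M) (d : ℕ) (X : Set N) :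
    f '' nbhd L d X ⊆ nbhd L d (f '' X) := by
  induction d with
  | zero => simp
  | succ d ih =>
    rintro _ ⟨b, hb, rfl⟩
    obtain ⟨c, hc, h⟩ := mem_nbhd_succ.1 hb
    refine mem_nbhd_succ.2 ⟨f c, ih ⟨c, hc, rfl⟩, ?_⟩
    rcases h with rfl | ⟨hne, n, R, x, hx, ⟨i, rfl⟩, ⟨j, rfl⟩⟩
    · exact Or.inl rfl
    · exact Or.inr ⟨fun h => hne (f.injective h), n, R, f ∘ x, (f.map_rel R x).2 hx,
        ⟨i, rfl⟩, ⟨j, rfl⟩⟩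

/-- Adjacency in `M` between points of the range need not come from `N`, since the witnessing tuple
may have other entries. Here all its entries lie in the ball of radius `d + 1`, hence in the range,
and the tuple pulls back. -/
theorem nbhd_image_subset (f : N ↪[L] M) {d : ℕ} {X : Set N}
    (h : nbhd L d (f '' X) ⊆ Set.range f) : nbhd L d (f '' X) ⊆ f '' nbhd L d X := by
  induction d with
  | zero => simp
  | succ d ih =>
    have ih := ih ((nbhd_mono_radius (Nat.le_succ d) _).trans h)
    intro b hb
    obtain ⟨c, hc, hcb⟩ := mem_nbhd_succ.1 hb
    obtain ⟨c', hc', rfl⟩ := ih hc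
    rcases hcb with rfl | ⟨hne, n, R, x, hx, hcx, ⟨j, rfl⟩⟩
    · exact ⟨c', nbhd_mono_radius (Nat.le_succ d) _ hc', rfl⟩
    · choose y hy using fun i => h (relMap_mem_nbhd_succ hc hx hcx i)
      obtain rfl : f ∘ y = x := funext hy
      obtain ⟨i, hi⟩ := hcx
      refine ⟨y j, ?_, rfl⟩
      rw [← f.injective hi] at hc'
      exact relMap_mem_nbhd_succ hc' ((f.map_rel R y).1 hx) ⟨i, rfl⟩ j

/-- Embeddings whose range contains the target ball preserve balls. -/
theorem nbhd_image_eq (f : N ↪[L] M) {d : ℕ} {X : Set N}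
    (h : nbhd L d (f '' X) ⊆ Set.range f) : nbhd L d (f '' X) = f '' nbhd L d X :=
  (nbhd_image_subset f h).antisymm (image_nbhd_subset f d X)

/-- A ball around a point of `X` which avoids the ball around the boundary stays in `X`. -/
theorem nbhd_subset_of_notMem {d : ℕ} {X : Set M} {a : M} (ha : a ∈ X)
    (h : a ∉ nbhd L d (outerBoundary L X)) : nbhd L d {a} ⊆ X := by
  have key : ∀ e ≤ d, nbhd L e {a} ⊆ X := by
    intro e
    induction e with
    | zero => intro _; simpa using ha
    | succ e ih =>
      intro he b hb
      by_contra hbX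
      obtain ⟨c, hc, hcb⟩ := mem_nbhd_succ.1 hb
      -- The first point reached outside `X` belongs to the outer boundary and is within `d` of `a`.
      refine h (mem_nbhd_iff.2 ⟨b, ⟨?_, hbX⟩, ?_⟩)
      · exact mem_nbhd_succ.2 ⟨c, by simpa using ih (by omega) hc, hcb⟩
      · exact nbhd_mono_radius he _ (mem_nbhd_singleton_comm.1 hb)
  exact key d le_rfl

/-- A point of `X` outside the ball around the boundary cannot be reached from outside. -/
theorem mem_of_mem_nbhd {d : ℕ} {X : Set M} {a b : M} (ha : a ∈ X)
    (hb : b ∉ nbhd L d (outerBoundary L X)) (hab : b ∈ nbhd L d {a}) : b ∈ X := by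
  by_contra hbX
  have key : ∀ e ≤ d, ∀ c ∈ nbhd L e {b}, c ∉ X := by
    intro e
    induction e with
    | zero => intro _ c hc; simp at hc; rwa [hc]
    | succ e ih =>
      intro he c hc hcX
      obtain ⟨c', hc', h⟩ := mem_nbhd_succ.1 hc
      have hc'X := ih (by omega) c' hc'
      rcases h with rfl | h
      · exact hc'X hcX
      · refine hb (mem_nbhd_iff.2 ⟨c', ⟨?_, hc'X⟩, ?_⟩)
        · exact mem_nbhd_succ.2 ⟨c, by simpa using hcX, Or.inr h.symm⟩
        · exact nbhd_mono_radius (by omega) _ (mem_nbhd_singleton_comm.1 hc')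
  exact key d le_rfl a (mem_nbhd_singleton_comm.1 hab) ha

end Neighbourhoods

/-! ### Transfer of local formulas -/

section Transfer

variable {L : FirstOrder.Language.{u, v}} [L.IsRelational] {M N : Type} [L.Structure M]
  [L.Structure N]

/-- Both sides are decided in the induced `r`-neighbourhoods, and `f` restricts to an isomorphism
between these by `nbhd_image_eq`. -/
theorem isLocalAt_realize_comp [Finite M] [Finite N] {r p : ℕ} {φ : L.Formula (Fin p)}
    (hφ : IsLocalAt r φ) (f : N ↪[L] M) (x : Fin p → N)
    (h : nbhd L r (Set.range (f ∘ x)) ⊆ Set.range f) : φ.Realize (f ∘ x) ↔ φ.Realize x := by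
  rw [hφ M (f ∘ x), hφ N x]
  rw [Set.range_comp] at h
  have himg := nbhd_image_eq f h
  have hmem : ∀ b, b ∈ nbhd L r (Set.range x) → f b ∈ nbhd L r (Set.range (f ∘ x)) := by
    intro b hb
    rw [Set.range_comp, himg]
    exact ⟨b, hb, rfl⟩
  let g : inducedOn L (nbhd L r (Set.range x)) → inducedOn L (nbhd L r (Set.range (f ∘ x))) :=
    fun b => ⟨f b, hmem b b.2⟩
  have hg : Function.Bijective g := by
    constructor
    · intro a b hab
      exact Subtype.ext (f.injective (congrArg Subtype.val hab))
    · rintro ⟨c, hc⟩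
      have hc' : c ∈ f '' nbhd L r (Set.range x) := by rw [← himg, ← Set.range_comp]; exact hc
      obtain ⟨b, hb, rfl⟩ := hc'
      exact ⟨⟨b, hb⟩, rfl⟩
  let e : inducedOn L (nbhd L r (Set.range x)) ≃[L]
      inducedOn L (nbhd L r (Set.range (f ∘ x))) :=
    { toEquiv := Equiv.ofBijective g hg
      map_fun' := fun {_} F => isEmptyElim F
      map_rel' := fun {_} R y => f.map_rel R (fun i => (y i : N)) }
  exact (StrongHomClass.realize_formula e φ (v := fun i => ⟨x i, subset_nbhd L r _ ⟨i, rfl⟩⟩))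

end Transfer

/-! ### Marked structures -/

section Marked

variable {L : FirstOrder.Language.{u, v}} {M N : Type} [L.Structure M] [L.Structure N]

/-- Satisfaction of a formula after marking the elements of `X`. -/
def HoldsMarked (X : Set M) {p : ℕ} (φ : (L.sum markLang).Formula (Fin p)) (x : Fin p → M) : Prop :=
  letI := markStructure X
  φ.Realize x

/-- A tuple of a unary relation has a single entry, so it creates no edge. -/
theorem gaifman_marked (X : Set M) :
    (letI := markStructure X; gaifman (L.sum markLang) M) = gaifman L M := by
  let _ := markStructure X
  ext a b
  constructor
  · rintro ⟨hne, n, R, x, hx, ⟨i, rfl⟩, ⟨j, rfl⟩⟩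
    rcases R with R | R
    · exact ⟨hne, n, R, x, hx, ⟨i, rfl⟩, ⟨j, rfl⟩⟩
    · cases R
      exact absurd (congrArg x (Subsingleton.elim i j)) hne
  · rintro ⟨hne, n, R, x, hx, ha, hb⟩
    exact ⟨hne, n, Sum.inl R, x, hx, ha, hb⟩

theorem nbhd_marked (X : Set M) (d : ℕ) (Y : Set M) :
    (letI := markStructure X; nbhd (L.sum markLang) d Y) = nbhd L d Y := by
  let _ := markStructure X
  have h : gaifman (L.sum markLang) M = gaifman L M := gaifman_marked X
  simp only [nbhd, h]

variable [L.IsRelational]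

theorem holdsMarked_comp [Finite M] [Finite N] {r p : ℕ} {φ : (L.sum markLang).Formula (Fin p)}
    (hφ : IsLocalAt r φ) (f : N ↪[L] M) {X : Set M} {Y : Set N} (hXY : ∀ a, f a ∈ X ↔ a ∈ Y)
    (x : Fin p → N) (h : nbhd L r (Set.range (f ∘ x)) ⊆ Set.range f) :
    HoldsMarked X φ (f ∘ x) ↔ HoldsMarked Y φ x := by
  let _ := markStructure X
  let _ := markStructure Y
  let g : N ↪[L.sum markLang] M :=
    { toEmbedding := f.toEmbedding
      map_fun' := fun {_} F => isEmptyElim F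
      map_rel' := by
        rintro n (R | R) y
        · exact f.map_rel R y
        · cases R
          exact hXY (y 0) }
  have hn := nbhd_marked (L := L) X r (Set.range (f ∘ x))
  refine isLocalAt_realize_comp hφ g x ?_
  change nbhd (L.sum markLang) r (Set.range (f ∘ x)) ⊆ Set.range f
  rw [hn]
  exact h

/-- The embedding of the substructure induced by a set. -/
abbrev inducedEmb (L : FirstOrder.Language.{u, v}) [L.IsRelational] {M : Type} [L.Structure M]
    (Y : Set M) : inducedOn L Y ↪[L] M :=
  (inducedOn L Y).subtype

theorem range_inducedEmb (Y : Set M) : Set.range (inducedEmb L Y) = Y := by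
  ext a
  constructor
  · rintro ⟨b, rfl⟩
    exact b.2
  · intro h
    exact ⟨⟨a, h⟩, rfl⟩

/-- The two markings coincide on the induced `r`-neighbourhood, where satisfaction is decided. -/
theorem holdsMarked_congr [Finite M] {r p : ℕ} {φ : (L.sum markLang).Formula (Fin p)}
    (hφ : IsLocalAt r φ) {X X' : Set M} {x : Fin p → M}
    (h : ∀ a ∈ nbhd L r (Set.range x), a ∈ X ↔ a ∈ X') : HoldsMarked X φ x ↔ HoldsMarked X' φ x := by
  set Y := nbhd L r (Set.range x) with hY
  let x' : Fin p → inducedOn L Y := fun i => ⟨x i, subset_nbhd L r _ ⟨i, rfl⟩⟩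
  have hr : nbhd L r (Set.range (inducedEmb L Y ∘ x')) ⊆ Set.range (inducedEmb L Y) := by
    rw [range_inducedEmb]
    exact subset_rfl
  have h₁ := holdsMarked_comp hφ (inducedEmb L Y) (X := X) (Y := {a | (a : M) ∈ X})
    (fun _ => Iff.rfl) x' hr
  have h₂ := holdsMarked_comp hφ (inducedEmb L Y) (X := X') (Y := {a | (a : M) ∈ X})
    (fun a => (h a a.2).symm) x' hr
  exact h₁.trans h₂.symm

end Marked

/-! ### Definability of distances and of marks by balls -/

section Definability

variable (L : FirstOrder.Language.{u, v})

/-- Symbols of arity below two give no edges, so adjacency is a finite disjunction over the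
remaining symbols and pairs of positions. This is where finiteness of their number enters. -/
theorem exists_nbhd_formula [Finite (Σ n, L.Relations (n + 2))] (d : ℕ) :
    ∃ ψ : L.Formula (Fin 2), ∀ (M : Type) [L.Structure M] (x : Fin 2 → M),
      ψ.Realize x ↔ x 1 ∈ nbhd L d {x 0} := by
  induction d with
  | zero =>
    refine ⟨(Term.var 0).equal (Term.var 1), fun M _ x => ?_⟩
    simp [Formula.realize_equal, eq_comm]
  | succ d ih =>
    obtain ⟨ψ, hψ⟩ := ih
    let co : L.Formula (Fin 2) := Formula.iSup
      (fun s : (Σ R : (Σ n, L.Relations (n + 2)), Fin (R.1 + 2) × Fin (R.1 + 2)) =>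
        Formula.iExs (Fin (s.1.1 + 2))
          ((Relations.formula s.1.2 (fun k => Term.var (Sum.inr k)) ⊓
            ((Term.var (Sum.inr s.2.1)).equal (Term.var (Sum.inl 0)) ⊓
            (Term.var (Sum.inr s.2.2)).equal (Term.var (Sum.inl 1))) :
              L.Formula (Fin 2 ⊕ Fin (s.1.1 + 2)))))
    -- `co` may also hold on the diagonal, so it is compared with adjacency only modulo equality.
    have hco : ∀ (M : Type) [L.Structure M] (x : Fin 2 → M),
        (x 0 = x 1 ∨ co.Realize x) ↔ (x 0 = x 1 ∨ (gaifman L M).Adj (x 0) (x 1)) := by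
      intro M _ x
      by_cases hx : x 0 = x 1
      · simp [hx]
      simp only [hx, false_or, co, Formula.realize_iSup, Formula.realize_iExs, Formula.realize_inf,
        Formula.realize_rel, Formula.realize_equal, Term.realize_var, Sum.elim_inl, Sum.elim_inr]
      constructor
      · rintro ⟨⟨⟨n, R⟩, i, j⟩, y, hy, hi, hj⟩
        exact ⟨hx, n + 2, R, y, hy, ⟨i, hi⟩, ⟨j, hj⟩⟩
      · rintro ⟨_, n, R, y, hy, ⟨i, hi⟩, ⟨j, hj⟩⟩
        match n, R, y, hy, i, hi, j, hj with
        | 0, _, _, _, i, _, _, _ => exact i.elim0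
        | 1, _, y, _, i, hi, j, hj =>
          rw [Subsingleton.elim i j] at hi
          exact absurd (hi.symm.trans hj) hx
        | n + 2, R, y, hy, i, hi, j, hj => exact ⟨⟨⟨n, R⟩, i, j⟩, y, hy, hi, hj⟩
    refine ⟨Formula.iExs (Fin 1)
      ((ψ.relabel ![Sum.inl 0, Sum.inr 0] ⊓
        ((Term.var (Sum.inr 0)).equal (Term.var (Sum.inl 1)) ⊔
          co.relabel ![Sum.inr 0, Sum.inl 1]) : L.Formula (Fin 2 ⊕ Fin 1))), fun M _ x => ?_⟩
    rw [mem_nbhd_succ, Formula.realize_iExs]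
    simp only [Formula.realize_inf, Formula.realize_sup, Formula.realize_relabel,
      Formula.realize_equal, Term.realize_var, Sum.elim_inl, Sum.elim_inr, hψ]
    constructor
    · rintro ⟨y, h₁, h₂⟩
      exact ⟨y 0, h₁, (hco M (Sum.elim x y ∘ ![Sum.inr 0, Sum.inl 1])).1 h₂⟩
    · rintro ⟨c, h₁, h₂⟩
      exact ⟨fun _ => c, h₁, ((hco M (Sum.elim x (fun _ => c) ∘ ![Sum.inr 0, Sum.inl 1])).2
        (by simpa using h₂)).imp_left (fun h => by simpa using h)⟩

variable {L} [L.IsRelational]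

theorem term_eq_var {α : Type*} (t : L.Term α) : ∃ i, t = Term.var i := by
  cases t with
  | var i => exact ⟨i, rfl⟩
  | func f _ => exact isEmptyElim f

/-- Replacing the mark by a ball centred at a new variable. -/
theorem exists_boundedFormula_marked [Finite (Σ n, L.Relations (n + 2))] (d p : ℕ) {n : ℕ}
    (φ : (L.sum markLang).BoundedFormula (Fin p) n) :
    ∃ ψ : L.BoundedFormula (Fin (p + 1)) n, ∀ (M : Type) [L.Structure M] (w : M) (x : Fin p → M)
      (y : Fin n → M), ψ.Realize (Fin.cons w x : Fin (p + 1) → M) y ↔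
        (letI := markStructure (nbhd L d {w}); φ.Realize x y) := by
  have hvar : ∀ {n : ℕ} (M : Type) (w : M) (x : Fin p → M) (y : Fin n → M) (i : Fin p ⊕ Fin n),
      Sum.elim (Fin.cons w x : Fin (p + 1) → M) y (Sum.map Fin.succ id i) = Sum.elim x y i := by
    rintro n M w x y (i | i) <;> simp
  induction φ with
  | falsum => exact ⟨BoundedFormula.falsum, fun M _ w x y => Iff.rfl⟩
  | equal t₁ t₂ =>
    obtain ⟨i, rfl⟩ := term_eq_var t₁
    obtain ⟨j, rfl⟩ := term_eq_var t₂
    refine ⟨.equal (Term.var (Sum.map Fin.succ id i)) (Term.var (Sum.map Fin.succ id j)),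
      fun M _ w x y => ?_⟩
    simp only [BoundedFormula.Realize, Term.realize_var, hvar]
  | @rel n k R ts =>
    choose i hi using fun k => term_eq_var (ts k)
    obtain rfl : ts = fun k => Term.var (i k) := funext hi
    rcases R with R | R
    · refine ⟨.rel R (fun k => Term.var (Sum.map Fin.succ id (i k))), fun M _ w x y => ?_⟩
      simp only [BoundedFormula.Realize, Term.realize_var, hvar]
      rfl
    · cases R
      obtain ⟨ψ, hψ⟩ := exists_nbhd_formula L d
      refine ⟨BoundedFormula.relabel (n := n) (k := 0) ![Sum.inl 0, Sum.map Fin.succ id (i 0)] ψ,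
        fun M _ w x y => ?_⟩
      rw [BoundedFormula.realize_relabel]
      have h0 := hψ M (Sum.elim (Fin.cons w x : Fin (p + 1) → M) y ∘
        ![Sum.inl 0, Sum.map Fin.succ id (i 0)])
      simp only [Function.comp, Matrix.cons_val_zero, Matrix.cons_val_one, hvar, Sum.elim_inl,
        Fin.cons_zero] at h0
      refine Iff.trans ?_ (h0.trans Iff.rfl)
      rw [Formula.Realize]
      refine iff_of_eq ?_
      congr 1
      exact Subsingleton.elim _ _
  | imp _ _ ih₁ ih₂ =>
    obtain ⟨ψ₁, h₁⟩ := ih₁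
    obtain ⟨ψ₂, h₂⟩ := ih₂
    refine ⟨ψ₁.imp ψ₂, fun M _ w x y => ?_⟩
    simp only [BoundedFormula.realize_imp, h₁, h₂]
  | all _ ih =>
    obtain ⟨ψ, h⟩ := ih
    refine ⟨ψ.all, fun M _ w x y => ?_⟩
    simp only [BoundedFormula.realize_all, h]

/-- Locality survives the elimination of the mark: the neighbourhood of radius `max r d` contains
the `r`-neighbourhood of the old variables and the whole `d`-ball of the centre, so that the ball is
the same when computed inside it. -/
theorem exists_formula_marked [Finite (Σ n, L.Relations (n + 2))] (d : ℕ) {p : ℕ}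
    {φ : (L.sum markLang).Formula (Fin p)} (hφ : IsLocal φ) :
    ∃ ψ : L.Formula (Fin (p + 1)), IsLocal ψ ∧ ∀ (M : Type) [L.Structure M] (w : M)
      (x : Fin p → M), ψ.Realize (Fin.cons w x : Fin (p + 1) → M) ↔
        HoldsMarked (nbhd L d {w}) φ x := by
  obtain ⟨ψ, hψ⟩ := exists_boundedFormula_marked (L := L) d p φ
  have hψ' : ∀ (M : Type) [L.Structure M] (w : M) (x : Fin p → M),
      ψ.Realize (Fin.cons w x : Fin (p + 1) → M) default ↔ HoldsMarked (nbhd L d {w}) φ x :=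
    fun M _ w x => hψ M w x default
  refine ⟨ψ, ?_, hψ'⟩
  obtain ⟨r, hr⟩ := hφ
  refine ⟨max r d, fun M _ _ x => ?_⟩
  set Y := nbhd L (max r d) (Set.range x) with hY
  let x' : Fin (p + 1) → inducedOn L Y := fun i => ⟨x i, subset_nbhd L _ _ ⟨i, rfl⟩⟩
  change ψ.Realize x default ↔ ψ.Realize x' default
  have hx : x = Fin.cons (x 0) (Fin.tail x) := (Fin.cons_self_tail x).symm
  have hx' : x' = Fin.cons (x' 0) (Fin.tail x') := (Fin.cons_self_tail x').symm
  rw [hx, hx', hψ', hψ']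
  have hsub : ∀ e ≤ max r d, ∀ Z ⊆ Set.range x, nbhd L e Z ⊆ Set.range (inducedEmb L Y) := by
    intro e he Z hZ
    rw [range_inducedEmb]
    exact (nbhd_mono_radius he Z).trans (nbhd_mono hZ)
  refine holdsMarked_comp hr (inducedEmb L Y) (fun a => ?_) (Fin.tail x') ?_
  · have h := nbhd_image_eq (inducedEmb L Y) (d := d) (X := {x' 0}) (by
      rw [Set.image_singleton]
      exact hsub d (le_max_right _ _) _ (Set.singleton_subset_iff.2 ⟨0, rfl⟩))
    rw [Set.image_singleton] at h
    change inducedEmb L Y a ∈ nbhd L d {inducedEmb L Y (x' 0)} ↔ _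
    rw [h, (inducedEmb L Y).injective.mem_set_image]
  · refine hsub r (le_max_left _ _) _ ?_
    rintro _ ⟨i, rfl⟩
    exact ⟨i.succ, rfl⟩

/-- Conjunction of two formulas on disjoint sets of variables. -/
theorem exists_formula_and {p q : ℕ} {φ : L.Formula (Fin p)} {ψ : L.Formula (Fin q)}
    (hφ : IsLocal φ) (hψ : IsLocal ψ) : ∃ χ : L.Formula (Fin (p + q)), IsLocal χ ∧
      ∀ (M : Type) [L.Structure M] (x : Fin p → M) (y : Fin q → M),
        χ.Realize (Fin.append x y) ↔ φ.Realize x ∧ ψ.Realize y := by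
  have hreal : ∀ (M : Type) [L.Structure M] (z : Fin (p + q) → M),
      (φ.relabel (Fin.castAdd q) ⊓ ψ.relabel (Fin.natAdd p) : L.Formula (Fin (p + q))).Realize z ↔
        φ.Realize (z ∘ Fin.castAdd q) ∧ ψ.Realize (z ∘ Fin.natAdd p) := by
    intro M _ z
    simp [Formula.realize_inf, Formula.realize_relabel]
  refine ⟨_, ?_, fun M _ x y => (hreal M _).trans ?_⟩
  · obtain ⟨r, hr⟩ := hφ
    obtain ⟨s, hs⟩ := hψ
    refine ⟨max r s, fun M _ _ z => ?_⟩
    set Y := nbhd L (max r s) (Set.range z) with hY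
    let z' : Fin (p + q) → inducedOn L Y := fun i => ⟨z i, subset_nbhd L _ _ ⟨i, rfl⟩⟩
    change _ ↔ (φ.relabel (Fin.castAdd q) ⊓ ψ.relabel (Fin.natAdd p) : L.Formula _).Realize z'
    rw [hreal, hreal]
    have hsub : ∀ e ≤ max r s, ∀ Z ⊆ Set.range z, nbhd L e Z ⊆ Set.range (inducedEmb L Y) := by
      intro e he Z hZ
      rw [range_inducedEmb]
      exact (nbhd_mono_radius he Z).trans (nbhd_mono hZ)
    refine and_congr ?_ ?_
    · refine isLocalAt_realize_comp hr (inducedEmb L Y) (z' ∘ Fin.castAdd q)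
        (hsub r (le_max_left _ _) _ ?_)
      rintro _ ⟨i, rfl⟩
      exact ⟨_, rfl⟩
    · refine isLocalAt_realize_comp hs (inducedEmb L Y) (z' ∘ Fin.natAdd p)
        (hsub s (le_max_right _ _) _ ?_)
      rintro _ ⟨i, rfl⟩
      exact ⟨_, rfl⟩
  · have h₁ : Fin.append x y ∘ Fin.castAdd q = x := by ext i; simp
    have h₂ : Fin.append x y ∘ Fin.natAdd p = y := by ext i; simp
    rw [h₁, h₂]

end Definability

/-! ### Measures of sets and Stone pairings -/

namespace FinStruct

section Meas

variable {L : FirstOrder.Language.{u, v}} (A : FinStruct L)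

open Classical in
theorem meas_eq_sum_ite (X : Set A.carrier) : A.meas X = ∑ a, if a ∈ X then A.weight a else 0 := by
  rw [meas, Finset.sum_filter]

theorem meas_nonneg (X : Set A.carrier) : 0 ≤ A.meas X :=
  Finset.sum_nonneg fun a _ => A.weight_nonneg a

@[simp] theorem meas_univ : A.meas Set.univ = 1 := by
  simp [meas, A.weight_sum]

@[simp] theorem meas_empty : A.meas ∅ = 0 := by
  simp [meas]

theorem meas_mono {X Y : Set A.carrier} (h : X ⊆ Y) : A.meas X ≤ A.meas Y := by
  classical
  refine Finset.sum_le_sum_of_subset_of_nonneg (fun a ha => ?_) fun a _ _ => A.weight_nonneg a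
  simp only [Finset.mem_filter, Finset.mem_univ, true_and] at ha ⊢
  exact h ha

theorem meas_le_one (X : Set A.carrier) : A.meas X ≤ 1 :=
  (A.meas_mono (Set.subset_univ X)).trans_eq A.meas_univ

theorem meas_union_add_inter (X Y : Set A.carrier) :
    A.meas (X ∪ Y) + A.meas (X ∩ Y) = A.meas X + A.meas Y := by
  classical
  simp only [meas_eq_sum_ite, ← Finset.sum_add_distrib]
  refine Finset.sum_congr rfl fun a _ => ?_
  by_cases hX : a ∈ X <;> by_cases hY : a ∈ Y <;> simp [hX, hY]

theorem meas_union_le (X Y : Set A.carrier) : A.meas (X ∪ Y) ≤ A.meas X + A.meas Y := by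
  linarith [A.meas_union_add_inter X Y, A.meas_nonneg (X ∩ Y)]

theorem meas_le_add {X Y Z : Set A.carrier} (h : X ⊆ Y ∪ Z) : A.meas X ≤ A.meas Y + A.meas Z :=
  (A.meas_mono h).trans (A.meas_union_le Y Z)

theorem meas_union_of_disjoint {X Y : Set A.carrier} (h : Disjoint X Y) :
    A.meas (X ∪ Y) = A.meas X + A.meas Y := by
  have := A.meas_union_add_inter X Y
  rwa [Set.disjoint_iff_inter_eq_empty.1 h, meas_empty, add_zero] at this

theorem meas_diff {X Y : Set A.carrier} (h : Y ⊆ X) : A.meas (X \ Y) = A.meas X - A.meas Y := by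
  have := A.meas_union_of_disjoint (X := X \ Y) (Y := Y) Set.disjoint_sdiff_left
  rw [Set.sdiff_union_of_subset h] at this
  linarith

theorem meas_iUnion_le {ι : Type*} (s : Finset ι) (X : ι → Set A.carrier) :
    A.meas (⋃ i ∈ s, X i) ≤ ∑ i ∈ s, A.meas (X i) := by
  classical
  induction s using Finset.induction_on with
  | empty => simp
  | insert i s hi ih =>
    rw [Finset.set_biUnion_insert, Finset.sum_insert hi]
    exact (A.meas_union_le _ _).trans (by linarith)

open Classical in
-- Markov's inequality.
theorem meas_mul_le_sum {f : A.carrier → ℝ} (hf : ∀ a, 0 ≤ f a) {t : ℝ} {X : Set A.carrier}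
    (hX : ∀ a ∈ X, t ≤ f a) : A.meas X * t ≤ ∑ a, A.weight a * f a := by
  rw [meas_eq_sum_ite, Finset.sum_mul]
  refine Finset.sum_le_sum fun a _ => ?_
  split_ifs with h
  · exact mul_le_mul_of_nonneg_left (hX a h) (A.weight_nonneg a)
  · rw [zero_mul]; exact mul_nonneg (A.weight_nonneg a) (hf a)

theorem sum_le_meas {f : A.carrier → ℝ} {X : Set A.carrier} (h1 : ∀ a, f a ≤ 1)
    (hX : ∀ a ∉ X, f a = 0) : ∑ a, A.weight a * f a ≤ A.meas X := by
  classical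
  rw [meas_eq_sum_ite]
  refine Finset.sum_le_sum fun a _ => ?_
  split_ifs with h
  · exact mul_le_of_le_one_right (A.weight_nonneg a) (h1 a)
  · rw [hX a h, mul_zero]

theorem ballMeas_nonneg (d : ℕ) (a : A.carrier) : 0 ≤ A.ballMeas d a := A.meas_nonneg _

theorem ballMeas_le_one (d : ℕ) (a : A.carrier) : A.ballMeas d a ≤ 1 := A.meas_le_one _

theorem ballMeas_mono {d e : ℕ} (h : d ≤ e) (a : A.carrier) : A.ballMeas d a ≤ A.ballMeas e a :=
  A.meas_mono (nbhd_mono_radius h _)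

end Meas

section Stone

variable {L : FirstOrder.Language.{u, v}} (A : FinStruct L)

theorem sum_prod_weight_mul (p : ℕ) (g : Fin p → A.carrier → ℝ) :
    ∑ x : Fin p → A.carrier, ∏ i, (g i (x i) * A.weight (x i)) =
      ∏ i, ∑ a, g i a * A.weight a := by
  classical
  rw [Finset.prod_univ_sum, Fintype.piFinset_univ]

theorem sum_prod_weight (p : ℕ) : ∑ x : Fin p → A.carrier, ∏ i, A.weight (x i) = 1 := by
  have := A.sum_prod_weight_mul p (fun _ _ => 1)
  simpa [A.weight_sum] using this

theorem prod_weight_nonneg {p : ℕ} (x : Fin p → A.carrier) : 0 ≤ ∏ i, A.weight (x i) :=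
  Finset.prod_nonneg fun _ _ => A.weight_nonneg _

open Classical in
theorem stonePairing_eq_sum_ite {p : ℕ} (φ : L.Formula (Fin p)) :
    A.stonePairing φ = ∑ x : Fin p → A.carrier, if φ.Realize x then ∏ i, A.weight (x i) else 0 := by
  rw [stonePairing, Finset.sum_filter]

theorem stonePairing_nonneg {p : ℕ} (φ : L.Formula (Fin p)) : 0 ≤ A.stonePairing φ :=
  Finset.sum_nonneg fun x _ => A.prod_weight_nonneg x

theorem stonePairing_le_one {p : ℕ} (φ : L.Formula (Fin p)) : A.stonePairing φ ≤ 1 := by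
  rw [← A.sum_prod_weight p]
  exact Finset.sum_le_sum_of_subset_of_nonneg (Finset.subset_univ _)
    fun x _ _ => A.prod_weight_nonneg x

theorem stonePairing_and {p q : ℕ} {φ : L.Formula (Fin p)} {ψ : L.Formula (Fin q)}
    {χ : L.Formula (Fin (p + q))} (h : ∀ (x : Fin p → A.carrier) (y : Fin q → A.carrier),
      χ.Realize (Fin.append x y) ↔ φ.Realize x ∧ ψ.Realize y) :
    A.stonePairing χ = A.stonePairing φ * A.stonePairing ψ := by
  classical
  rw [stonePairing_eq_sum_ite, stonePairing_eq_sum_ite, stonePairing_eq_sum_ite,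
    Finset.sum_mul_sum, ← (Fin.appendEquiv p q).sum_comp, Fintype.sum_prod_type]
  refine Finset.sum_congr rfl fun x _ => Finset.sum_congr rfl fun y _ => ?_
  change (if χ.Realize (Fin.append x y) then ∏ i, A.weight (Fin.append x y i) else 0) = _
  rw [Fin.prod_univ_add]
  simp only [Fin.append_left, Fin.append_right, h]
  by_cases h₁ : φ.Realize x <;> by_cases h₂ : ψ.Realize y <;> simp [h₁, h₂]

open Classical in
theorem stonePairing_mark {p : ℕ} (X : Set A.carrier) (φ : (L.sum markLang).Formula (Fin p)) :
    (A.mark X).stonePairing φ =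
      ∑ x : Fin p → A.carrier, if HoldsMarked X φ x then ∏ i, A.weight (x i) else 0 :=
  (A.mark X).stonePairing_eq_sum_ite φ

/-- Fubini: the centre is drawn first, then the remaining variables. -/
theorem stonePairing_cons {d p : ℕ} {φ : (L.sum markLang).Formula (Fin p)}
    {ψ : L.Formula (Fin (p + 1))} (h : ∀ (w : A.carrier) (x : Fin p → A.carrier),
      ψ.Realize (Fin.cons w x : Fin (p + 1) → A.carrier) ↔ HoldsMarked (nbhd L d {w}) φ x) :
    A.stonePairing ψ = ∑ w, A.weight w * (A.mark (nbhd L d {w})).stonePairing φ := by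
  classical
  rw [stonePairing_eq_sum_ite, ← (Fin.consEquiv fun _ => A.carrier).sum_comp,
    Fintype.sum_prod_type]
  refine Finset.sum_congr rfl fun w _ => ?_
  rw [stonePairing_mark, Finset.mul_sum]
  refine Finset.sum_congr rfl fun x _ => ?_
  change (if ψ.Realize (Fin.cons w x : Fin (p + 1) → A.carrier) then
    ∏ i, A.weight ((Fin.cons w x : Fin (p + 1) → A.carrier) i) else 0) = _
  rw [Fin.prod_univ_succ]
  simp only [Fin.cons_zero, Fin.cons_succ, h, mul_ite, mul_zero]

theorem sum_prod_weight_coord {p : ℕ} (i : Fin p) (B : Set A.carrier) [DecidablePred (· ∈ B)] :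
    ∑ x : Fin p → A.carrier, (if x i ∈ B then ∏ j, A.weight (x j) else 0) = A.meas B := by
  have h := A.sum_prod_weight_mul p (fun j a => if j = i then (if a ∈ B then 1 else 0) else 1)
  have h₁ : ∀ j, (∑ a, (if j = i then (if a ∈ B then (1 : ℝ) else 0) else 1) * A.weight a) =
      if j = i then A.meas B else 1 := by
    intro j
    split_ifs
    · rw [meas_eq_sum_ite]
      refine Finset.sum_congr rfl fun a _ => ?_
      by_cases ha : a ∈ B <;> simp [ha]
    · simp [A.weight_sum]
  simp only [h₁, Finset.prod_ite_eq', Finset.mem_univ, if_true] at h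
  rw [← h]
  refine Finset.sum_congr rfl fun x _ => ?_
  rw [Finset.prod_mul_distrib, Finset.prod_ite_eq']
  simp

/-- Changing the marks near a set of small measure changes Stone pairings little. -/
theorem abs_stonePairing_mark_sub_le [L.IsRelational] {r p : ℕ}
    {φ : (L.sum markLang).Formula (Fin p)} (hφ : IsLocalAt r φ) {X Y B : Set A.carrier}
    (h₁ : nbhd L r (X \ Y) ⊆ B) (h₂ : nbhd L r (Y \ X) ⊆ B) :
    |(A.mark X).stonePairing φ - (A.mark Y).stonePairing φ| ≤ p * A.meas B := by
  classical
  -- Union bound: `φ` can distinguish the two markings only if some coordinate falls in `B`.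
  have hpt : ∀ x : Fin p → A.carrier,
      |(if HoldsMarked X φ x then ∏ i, A.weight (x i) else 0) -
        (if HoldsMarked Y φ x then ∏ i, A.weight (x i) else 0)| ≤
      ∑ i, if x i ∈ B then ∏ j, A.weight (x j) else 0 := by
    intro x
    have h0 := A.prod_weight_nonneg x
    have hnn : ∀ i ∈ (Finset.univ : Finset (Fin p)),
        0 ≤ (if x i ∈ B then ∏ j, A.weight (x j) else 0) := by
      intro i _
      split_ifs <;> simp [h0]
    by_cases hx : ∃ i, x i ∈ B
    · obtain ⟨i, hi⟩ := hx
      refine le_trans ?_ (Finset.single_le_sum hnn (Finset.mem_univ i))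
      rw [if_pos hi]
      by_cases hX : HoldsMarked X φ x <;> by_cases hY : HoldsMarked Y φ x <;>
        simp [hX, hY, h0, abs_of_nonneg h0]
    · push Not at hx
      have : HoldsMarked X φ x ↔ HoldsMarked Y φ x := by
        refine holdsMarked_congr hφ fun a ha => ?_
        obtain ⟨_, ⟨i, rfl⟩, hai⟩ := mem_nbhd_iff.1 ha
        rw [mem_nbhd_singleton_comm] at hai
        constructor
        · intro haX
          by_contra haY
          exact hx i (h₁ (mem_nbhd_iff.2 ⟨a, ⟨haX, haY⟩, hai⟩))
        · intro haY
          by_contra haX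
          exact hx i (h₂ (mem_nbhd_iff.2 ⟨a, ⟨haY, haX⟩, hai⟩))
      simp only [this, sub_self, abs_zero]
      exact Finset.sum_nonneg hnn
  rw [stonePairing_mark, stonePairing_mark, ← Finset.sum_sub_distrib]
  refine (Finset.abs_sum_le_sum_abs _ _).trans ((Finset.sum_le_sum fun x _ => hpt x).trans ?_)
  rw [Finset.sum_comm]
  simp [sum_prod_weight_coord]

end Stone

end FinStruct

/-! ### Products of Stone pairings and averages over marked balls -/

section LocalStatistics

variable {L : FirstOrder.Language.{u, v}}

/-- The symbol of the mark. -/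
def markSymbol (L : FirstOrder.Language.{u, v}) : (L.sum markLang).Relations 1 :=
  Sum.inr MarkRel.mark

/-- The formula stating that its variable is marked. -/
def markFormula (L : FirstOrder.Language.{u, v}) : (L.sum markLang).Formula (Fin 1) :=
  (markSymbol L).formula (fun i => Term.var i)

theorem stonePairing_markFormula (A : FinStruct L) (X : Set A.carrier) :
    (A.mark X).stonePairing (markFormula L) = A.meas X := by
  classical
  have h : ∀ x : Fin 1 → A.carrier, HoldsMarked X (markFormula L) x ↔ x 0 ∈ X := by
    intro x
    let _ := markStructure X
    exact Formula.realize_rel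
  rw [FinStruct.stonePairing_mark]
  simp only [h]
  exact A.sum_prod_weight_coord 0 X

theorem stonePairing_top (A : FinStruct L) : A.stonePairing (⊤ : L.Formula (Fin 0)) = 1 := by
  rw [FinStruct.stonePairing]
  simp [Formula.realize_top]

variable [L.IsRelational]

theorem isLocal_top : IsLocal (⊤ : L.Formula (Fin 0)) :=
  ⟨0, fun M _ _ x => by simp [Formula.realize_top]⟩

theorem isLocal_markFormula : IsLocal (markFormula L) :=
  ⟨0, fun M _ _ x => by
    rw [markFormula, Formula.realize_rel, Formula.realize_rel]
    rfl⟩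

theorem exists_formula_mul {p q : ℕ} {φ : L.Formula (Fin p)} {ψ : L.Formula (Fin q)}
    (hφ : IsLocal φ) (hψ : IsLocal ψ) : ∃ χ : L.Formula (Fin (p + q)), IsLocal χ ∧
      ∀ A : FinStruct L, A.stonePairing χ = A.stonePairing φ * A.stonePairing ψ := by
  obtain ⟨χ, hχ, h⟩ := exists_formula_and hφ hψ
  exact ⟨χ, hχ, fun A => A.stonePairing_and fun x y => h A.carrier x y⟩

/-- Each fresh variable required to be marked contributes one factor `A.meas X`; this gives access
to the moments of ball measures. -/
theorem exists_formula_meas_pow_mul (k : ℕ) {p : ℕ} {φ : (L.sum markLang).Formula (Fin p)}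
    (hφ : IsLocal φ) : ∃ (q : ℕ) (χ : (L.sum markLang).Formula (Fin q)), IsLocal χ ∧
      ∀ (A : FinStruct L) (X : Set A.carrier),
        (A.mark X).stonePairing χ = A.meas X ^ k * (A.mark X).stonePairing φ := by
  induction k with
  | zero => exact ⟨p, φ, hφ, fun A X => by simp⟩
  | succ k ih =>
    obtain ⟨q, χ, hχ, h⟩ := ih
    obtain ⟨χ', hχ', h'⟩ := exists_formula_mul isLocal_markFormula hχ
    refine ⟨_, χ', hχ', fun A X => ?_⟩
    rw [h', h, stonePairing_markFormula]
    ring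

/-- Averages over the centre of local statistics of marked balls converge. -/
theorem LocalConvergent.tendsto_sum_ball [Finite (Σ n, L.Relations (n + 2))] {A : ℕ → FinStruct L}
    (hA : LocalConvergent A) (d k : ℕ) {p : ℕ} {φ : (L.sum markLang).Formula (Fin p)}
    (hφ : IsLocal φ) : ∃ l : ℝ, Tendsto (fun n => ∑ w, (A n).weight w *
      ((A n).ballMeas d w ^ k * ((A n).mark (nbhd L d {w})).stonePairing φ)) atTop (𝓝 l) := by
  obtain ⟨q, χ, hχ, h⟩ := exists_formula_meas_pow_mul k hφ
  obtain ⟨ψ, hψ, hψ'⟩ := exists_formula_marked d hχ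
  obtain ⟨l, hl⟩ := hA _ ψ hψ
  refine ⟨l, hl.congr fun n => ?_⟩
  rw [(A n).stonePairing_cons (fun w x => hψ' (A n).carrier w x)]
  simp only [h]
  rfl

end LocalStatistics

/-! ### Measures on the unit interval and convergence of moments -/

section Moments

theorem exists_tendsto_of_approx {u : ℕ → ℝ}
    (h : ∀ ε > 0, ∃ (v : ℕ → ℝ) (l : ℝ), Tendsto v atTop (𝓝 l) ∧ ∀ᶠ n in atTop, |u n - v n| ≤ ε) :
    ∃ l, Tendsto u atTop (𝓝 l) := by
  refine cauchySeq_tendsto_of_complete (Metric.cauchySeq_iff'.2 fun ε hε => ?_)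
  obtain ⟨v, l, hv, huv⟩ := h (ε / 5) (by positivity)
  obtain ⟨N, hN⟩ := eventually_atTop.1
    ((Metric.tendsto_nhds.1 hv (ε / 5) (by positivity)).and huv)
  refine ⟨N, fun n hn => ?_⟩
  have h₁ := hN n hn
  have h₂ := hN N le_rfl
  rw [Real.dist_eq] at h₁ h₂ ⊢
  have h₁' := abs_lt.1 h₁.1
  have h₂' := abs_lt.1 h₂.1
  have h₁'' := abs_le.1 h₁.2
  have h₂'' := abs_le.1 h₂.2
  rw [abs_lt]
  constructor <;> linarith

/-- Weierstrass: for functionals bounded on the unit interval, convergence on monomials implies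
convergence on continuous functions. -/
theorem exists_tendsto_of_moments {Λ : ℕ → C(ℝ, ℝ) →ₗ[ℝ] ℝ}
    (hΛ : ∀ n (f : C(ℝ, ℝ)) (c : ℝ), (∀ x ∈ Set.Icc (0 : ℝ) 1, |f x| ≤ c) → |Λ n f| ≤ c)
    (hm : ∀ k : ℕ, ∃ l, Tendsto (fun n => Λ n (ContinuousMap.id ℝ ^ k)) atTop (𝓝 l))
    (f : C(ℝ, ℝ)) : ∃ l, Tendsto (fun n => Λ n f) atTop (𝓝 l) := by
  have hpoly : ∀ q : Polynomial ℝ, ∃ l, Tendsto (fun n => Λ n q.toContinuousMap) atTop (𝓝 l) := by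
    intro q
    induction q using Polynomial.induction_on' with
    | add p q hp hq =>
      obtain ⟨a, ha⟩ := hp
      obtain ⟨b, hb⟩ := hq
      refine ⟨a + b, (ha.add hb).congr fun n => ?_⟩
      rw [← map_add]
      congr 1
      ext x
      simp
    | monomial k a =>
      obtain ⟨l, hl⟩ := hm k
      refine ⟨a * l, (hl.const_mul a).congr fun n => ?_⟩
      rw [← smul_eq_mul, ← map_smul]
      congr 1
      ext x
      simp
  refine exists_tendsto_of_approx fun ε hε => ?_
  obtain ⟨q, hq⟩ := exists_polynomial_near_of_continuousOn 0 1 f f.continuous.continuousOn ε hε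
  obtain ⟨l, hl⟩ := hpoly q
  refine ⟨_, l, hl, Eventually.of_forall fun n => ?_⟩
  rw [← map_sub]
  refine hΛ n _ ε fun x hx => ?_
  rw [ContinuousMap.sub_apply, abs_sub_comm]
  exact (hq x hx).le

/-- The retraction of the line to the unit interval. -/
def clamp : C(ℝ, ℝ) := ⟨fun x => max 0 (min 1 x), by fun_prop⟩

theorem clamp_mem (x : ℝ) : clamp x ∈ Set.Icc (0 : ℝ) 1 :=
  ⟨le_max_left _ _, max_le zero_le_one (min_le_left _ _)⟩

theorem clamp_eq {x : ℝ} (hx : x ∈ Set.Icc (0 : ℝ) 1) : clamp x = x := by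
  change max 0 (min 1 x) = x
  rw [min_eq_right hx.2, max_eq_right hx.1]

/-- The bounded continuous function with the same values on the unit interval as `f`. -/
def clamped (f : C(ℝ, ℝ)) : ℝ →ᵇ ℝ :=
  (BoundedContinuousFunction.mkOfCompact (f.restrict (Set.Icc (0 : ℝ) 1))).compContinuous
    ⟨fun x => ⟨clamp x, clamp_mem x⟩, by fun_prop⟩

theorem clamped_apply (f : C(ℝ, ℝ)) (x : ℝ) : clamped f x = f (clamp x) := rfl

theorem ae_eq_clamped {μ : Measure ℝ} (hμ : μ (Set.Icc 0 1)ᶜ = 0) (f : C(ℝ, ℝ)) :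
    f =ᵐ[μ] clamped f := by
  filter_upwards [compl_mem_ae_iff.2 hμ] with x hx
  rw [compl_compl] at hx
  rw [clamped_apply, clamp_eq hx]

theorem integrable_of_unitInterval {μ : Measure ℝ} [IsFiniteMeasure μ] (hμ : μ (Set.Icc 0 1)ᶜ = 0)
    (f : C(ℝ, ℝ)) : Integrable f μ :=
  ((clamped f).integrable μ).congr (ae_eq_clamped hμ f).symm

theorem tendsto_integral_of_unitInterval {ι : Type*} {F : Filter ι} {μ : ι → ProbabilityMeasure ℝ}
    {ν : ProbabilityMeasure ℝ} (h : Tendsto μ F (𝓝 ν))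
    (hμ : ∀ i, (μ i : Measure ℝ) (Set.Icc 0 1)ᶜ = 0) (hν : (ν : Measure ℝ) (Set.Icc 0 1)ᶜ = 0)
    (f : C(ℝ, ℝ)) : Tendsto (fun i => ∫ x, f x ∂(μ i : Measure ℝ)) F (𝓝 (∫ x, f x ∂(ν : Measure ℝ))) := by
  rw [integral_congr_ae (ae_eq_clamped hν f)]
  refine (ProbabilityMeasure.tendsto_iff_forall_integral_tendsto.1 h (clamped f)).congr fun i => ?_
  rw [integral_congr_ae (ae_eq_clamped (hμ i) f)]

/-- Tightness provides a limit `ν` along an ultrafilter. By Weierstrass the integrals of every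
bounded continuous function converge along the whole sequence, necessarily to the value given by
`ν`. -/
theorem exists_limit_of_moments {μ : ℕ → ProbabilityMeasure ℝ}
    (hμ : ∀ i, (μ i : Measure ℝ) (Set.Icc 0 1)ᶜ = 0)
    (hm : ∀ k : ℕ, ∃ l, Tendsto (fun n => ∫ x, x ^ k ∂(μ n : Measure ℝ)) atTop (𝓝 l)) :
    ∃ ν : ProbabilityMeasure ℝ, Tendsto μ atTop (𝓝 ν) ∧ (ν : Measure ℝ) (Set.Icc 0 1)ᶜ = 0 := by
  have htight : IsTightMeasureSet {((ν : ProbabilityMeasure ℝ) : Measure ℝ) | ν ∈ Set.range μ} := by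
    refine isTightMeasureSet_iff_exists_isCompact_measure_compl_le.2
      fun ε _ => ⟨Set.Icc 0 1, isCompact_Icc, ?_⟩
    rintro _ ⟨_, ⟨n, rfl⟩, rfl⟩
    rw [hμ n]
    exact zero_le
  have hcomp := isCompact_closure_of_isTightMeasureSet htight
  obtain ⟨ν, -, hν⟩ := hcomp.ultrafilter_le_nhds ((hyperfilter ℕ).map μ) (by
    rw [le_principal_iff]
    exact mem_map.2 (univ_mem' fun n => subset_closure ⟨n, rfl⟩))
  have hν : Tendsto μ (hyperfilter ℕ) (𝓝 ν) := hν
  have hle : (hyperfilter ℕ : Filter ℕ) ≤ atTop := Nat.hyperfilter_le_atTop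
  have hsupp : (ν : Measure ℝ) (Set.Icc 0 1)ᶜ = 0 := by
    have h := ProbabilityMeasure.le_liminf_measure_open_of_tendsto hν
      (isClosed_Icc (a := (0 : ℝ)) (b := 1)).isOpen_compl
    simpa [hμ] using h
  refine ⟨ν, ProbabilityMeasure.tendsto_iff_forall_integral_tendsto.2 fun f => ?_, hsupp⟩
  let Λ : ℕ → C(ℝ, ℝ) →ₗ[ℝ] ℝ := fun n =>
    { toFun := fun g => ∫ x, g x ∂(μ n : Measure ℝ)
      map_add' := fun g h => integral_add (integrable_of_unitInterval (hμ n) g)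
        (integrable_of_unitInterval (hμ n) h)
      map_smul' := fun c g => integral_const_mul c _ }
  obtain ⟨l, hl⟩ := exists_tendsto_of_moments (Λ := Λ) (fun n g c hc => by
    have := norm_integral_le_of_norm_le_const (μ := (μ n : Measure ℝ)) (f := g) (C := c) (by
      filter_upwards [compl_mem_ae_iff.2 (hμ n)] with x hx
      rw [compl_compl] at hx
      exact hc x hx)
    simpa [Λ] using this) (fun k => by
      obtain ⟨l, hl⟩ := hm k
      refine ⟨l, hl.congr fun n => ?_⟩
      simp [Λ]) f.toContinuousMap
  have hl : Tendsto (fun n => ∫ x, f x ∂(μ n : Measure ℝ)) atTop (𝓝 l) := hl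
  have := tendsto_nhds_unique (hl.mono_left hle)
    (ProbabilityMeasure.tendsto_iff_forall_integral_tendsto.1 hν f)
  rwa [← this]

end Moments

/-! ### Existence of the spectrum -/

section Spectrum

variable {L : FirstOrder.Language.{u, v}}

theorem FinStruct.integral_ballLaw (A : FinStruct L) (d : ℕ) (f : ℝ → ℝ) :
    ∫ x, f x ∂(A.ballLaw d : Measure ℝ) = ∑ a, A.weight a * f (A.ballMeas d a) := by
  change ∫ x, f x ∂(∑ a, ENNReal.ofReal (A.weight a) • Measure.dirac (A.ballMeas d a)) = _
  rw [integral_finsetSum_measure]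
  · refine Finset.sum_congr rfl fun a _ => ?_
    rw [integral_smul_measure, integral_dirac, ENNReal.toReal_ofReal (A.weight_nonneg a),
      smul_eq_mul]
  · intro a _
    exact (integrable_dirac (by simp)).smul_measure ENNReal.ofReal_ne_top

theorem FinStruct.ballLaw_compl (A : FinStruct L) (d : ℕ) :
    (A.ballLaw d : Measure ℝ) (Set.Icc 0 1)ᶜ = 0 := by
  change (∑ a, ENNReal.ofReal (A.weight a) • Measure.dirac (A.ballMeas d a)) _ = 0
  simp only [Measure.coe_finsetSum, Finset.sum_apply, Measure.smul_apply, smul_eq_mul]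
  refine Finset.sum_eq_zero fun a _ => ?_
  rw [Measure.dirac_apply' _ measurableSet_Icc.compl, Set.indicator_of_notMem, mul_zero]
  exact fun h => h ⟨A.ballMeas_nonneg d a, A.ballMeas_le_one d a⟩

theorem LocalConvergent.tendsto_moment [L.IsRelational] [Finite (Σ n, L.Relations (n + 2))]
    {A : ℕ → FinStruct L} (hA : LocalConvergent A) (d k : ℕ) :
    ∃ l, Tendsto (fun n => ∑ w, (A n).weight w * (A n).ballMeas d w ^ k) atTop (𝓝 l) := by
  obtain ⟨l, hl⟩ := hA.tendsto_sum_ball d k (isLocal_top (L := L.sum markLang))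
  refine ⟨l, hl.congr fun n => Finset.sum_congr rfl fun w _ => ?_⟩
  rw [stonePairing_top, mul_one]

/-- For fixed `d` the moments of the ball measure are Stone pairings of local formulas. Their limits
increase with `d` and are bounded by one, so the second limit exists too. -/
theorem exists_isSpectrum [L.IsRelational] [Finite (Σ n, L.Relations (n + 2))]
    {A : ℕ → FinStruct L} (hA : LocalConvergent A) : ∃ P : ProbabilityMeasure ℝ, IsSpectrum A P := by
  have hQ : ∀ d, ∃ Q : ProbabilityMeasure ℝ,
      Tendsto (fun n => (A n).ballLaw d) atTop (𝓝 Q) ∧ (Q : Measure ℝ) (Set.Icc 0 1)ᶜ = 0 := by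
    intro d
    refine exists_limit_of_moments (fun n => (A n).ballLaw_compl d) fun k => ?_
    simp only [FinStruct.integral_ballLaw]
    exact hA.tendsto_moment d k
  choose Q hQ hQ' using hQ
  have hmom : ∀ d k, Tendsto (fun n => ∑ w, (A n).weight w * (A n).ballMeas d w ^ k) atTop
      (𝓝 (∫ x, x ^ k ∂(Q d : Measure ℝ))) := by
    intro d k
    have := tendsto_integral_of_unitInterval (hQ d) (fun n => (A n).ballLaw_compl d) (hQ' d)
      (ContinuousMap.id ℝ ^ k)
    simp only [ContinuousMap.coe_pow, ContinuousMap.coe_id, Pi.pow_apply, id_eq,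
      FinStruct.integral_ballLaw] at this
    exact this
  obtain ⟨P, hP, -⟩ := exists_limit_of_moments hQ' fun k => by
    refine ⟨_, tendsto_atTop_ciSup (f := fun d => ∫ x, x ^ k ∂(Q d : Measure ℝ)) ?_ ⟨1, ?_⟩⟩
    · intro d e hde
      refine le_of_tendsto_of_tendsto' (hmom d k) (hmom e k) fun n => ?_
      refine Finset.sum_le_sum fun w _ => mul_le_mul_of_nonneg_left ?_ ((A n).weight_nonneg w)
      exact pow_le_pow_left₀ ((A n).ballMeas_nonneg d w) ((A n).ballMeas_mono hde w) k
    · rintro _ ⟨d, rfl⟩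
      refine le_of_tendsto' (hmom d k) fun n => ?_
      rw [← (A n).weight_sum]
      refine Finset.sum_le_sum fun w _ => mul_le_of_le_one_right ((A n).weight_nonneg w) ?_
      exact pow_le_one₀ ((A n).ballMeas_nonneg d w) ((A n).ballMeas_le_one d w)
  exact ⟨P, Q, hQ, hP⟩

/-- The form in which the iterated limit is used: first a large radius, then `n` large depending on
it. -/
theorem IsSpectrum.eventually {A : ℕ → FinStruct L} {P : ProbabilityMeasure ℝ} (h : IsSpectrum A P)
    (g : ℝ →ᵇ ℝ) {ε : ℝ} (hε : 0 < ε) : ∀ᶠ d in atTop, ∀ᶠ n in atTop,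
      |∑ w, (A n).weight w * g ((A n).ballMeas d w) - ∫ x, g x ∂(P : Measure ℝ)| < ε := by
  obtain ⟨Q, hQ, hP⟩ := h
  have h₁ := Metric.tendsto_nhds.1
    (ProbabilityMeasure.tendsto_iff_forall_integral_tendsto.1 hP g) (ε / 2) (by positivity)
  filter_upwards [h₁] with d hd
  have h₂ := Metric.tendsto_nhds.1
    (ProbabilityMeasure.tendsto_iff_forall_integral_tendsto.1 (hQ d) g) (ε / 2) (by positivity)
  filter_upwards [h₂] with n hn
  rw [FinStruct.integral_ballLaw, Real.dist_eq] at hn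
  rw [Real.dist_eq] at hd
  refine (abs_sub_le _ _ _).trans_lt ((add_lt_add hn hd).trans_eq (by ring))

end Spectrum

/-! ### Atoms -/

section Atoms

theorem massAt_eq (P : ProbabilityMeasure ℝ) (x : ℝ) :
    massAt P x = (P : Measure ℝ).real {x} := by
  have h := (ProbabilityTheory.cdf (P : Measure ℝ)).measure_singleton x
  rw [ProbabilityTheory.measure_cdf] at h
  rw [measureReal_def, h, ENNReal.toReal_ofReal, massAt]
  exact sub_nonneg.2 ((ProbabilityTheory.monotone_cdf _).leftLim_le le_rfl)

theorem massAt_pos {P : ProbabilityMeasure ℝ} {x : ℝ} (hx : x ∈ atoms P) : 0 < massAt P x := by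
  have hmono := ProbabilityTheory.monotone_cdf (P : Measure ℝ)
  refine sub_pos.2 (lt_of_le_of_ne (hmono.leftLim_le le_rfl) fun h => hx ?_)
  rw [hmono.continuousAt_iff_leftLim_eq_rightLim, StieltjesFunction.rightLim_eq]
  exact h

/-- The trapezoidal bump around `c`, equal to `1` up to distance `ε` and to `0` from `2 ε` on. -/
def bump (c ε : ℝ) : ℝ →ᵇ ℝ :=
  BoundedContinuousFunction.ofNormedAddCommGroup (fun x => max 0 (min 1 (2 - |x - c| / ε)))
    (by fun_prop) 1 (fun x => by
      rw [Real.norm_eq_abs, abs_of_nonneg (le_max_left _ _)]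
      exact max_le zero_le_one (min_le_left _ _))

theorem bump_nonneg (c ε x : ℝ) : 0 ≤ bump c ε x := le_max_left _ _

theorem bump_le_one (c ε x : ℝ) : bump c ε x ≤ 1 := max_le zero_le_one (min_le_left _ _)

theorem bump_eq_one {c ε x : ℝ} (hε : 0 < ε) (h : |x - c| ≤ ε) : bump c ε x = 1 := by
  change max 0 (min 1 (2 - |x - c| / ε)) = 1
  have : |x - c| / ε ≤ 1 := (div_le_one hε).2 h
  rw [min_eq_left (by linarith), max_eq_right zero_le_one]

theorem bump_eq_zero {c ε x : ℝ} (hε : 0 < ε) (h : 2 * ε ≤ |x - c|) : bump c ε x = 0 := by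
  change max 0 (min 1 (2 - |x - c| / ε)) = 0
  have : 2 ≤ |x - c| / ε := (le_div_iff₀ hε).2 h
  exact max_eq_left ((min_le_right _ _).trans (by linarith))

theorem le_integral_bump (P : ProbabilityMeasure ℝ) (c : ℝ) {ε : ℝ} (hε : 0 < ε) :
    (P : Measure ℝ).real {c} ≤ ∫ x, bump c ε x ∂(P : Measure ℝ) := by
  rw [← integral_indicator_one (measurableSet_singleton c)]
  refine integral_mono ((integrable_const 1).indicator (measurableSet_singleton c))
    ((bump c ε).integrable _) fun x => ?_
  by_cases hx : x = c
  · rw [hx, bump_eq_one hε (by simpa using hε.le)]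
    simp
  · simpa [hx] using bump_nonneg c ε x

theorem exists_integral_bump_lt (P : ProbabilityMeasure ℝ) (c : ℝ) {δ : ℝ} (hδ : 0 < δ) :
    ∃ ε > 0, ∫ x, bump c ε x ∂(P : Measure ℝ) < (P : Measure ℝ).real {c} + δ := by
  have h := tendsto_measure_cthickening_of_isClosed (μ := (P : Measure ℝ))
    (s := {c}) ⟨1, one_pos, measure_ne_top _ _⟩ isClosed_singleton
  have h' := (ENNReal.tendsto_toReal (measure_ne_top (P : Measure ℝ) {c})).comp h
  have h'' := (h'.eventually (gt_mem_nhds (show ((P : Measure ℝ) {c}).toReal <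
    (P : Measure ℝ).real {c} + δ from lt_add_of_pos_right _ hδ)))
  obtain ⟨r, hr, hr'⟩ := Metric.eventually_nhds_iff.1 h''
  -- A bump of parameter `r / 4` vanishes outside the ball of radius `r / 2`.
  refine ⟨r / 4, by positivity, lt_of_le_of_lt ?_ (hr' (y := r / 2) (by
    rw [Real.dist_eq, sub_zero, abs_of_pos (by positivity)]; linarith))⟩
  change _ ≤ (P : Measure ℝ).real (Metric.cthickening (r / 2) {c})
  rw [Metric.cthickening_singleton _ (by positivity)]
  rw [← integral_indicator_one Metric.isClosed_closedBall.measurableSet]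
  refine integral_mono ((bump c _).integrable _)
    ((integrable_const 1).indicator Metric.isClosed_closedBall.measurableSet) fun x => ?_
  by_cases hx : x ∈ Metric.closedBall c (r / 2)
  · rw [Set.indicator_of_mem hx]
    exact bump_le_one _ _ _
  · rw [Set.indicator_of_notMem hx]
    rw [Metric.mem_closedBall, Real.dist_eq, not_le] at hx
    exact (bump_eq_zero (by positivity) (by linarith)).le

end Atoms

section Globular

variable {L : FirstOrder.Language.{u, v}}

/-! ### Restriction to a set of positive measure -/

namespace FinStruct

theorem nonempty_carrier (A : FinStruct L) : Nonempty A.carrier := by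
  by_contra h
  rw [not_nonempty_iff] at h
  simpa using A.weight_sum

theorem bddAbove_ballMeas (A : FinStruct L) (d : ℕ) :
    BddAbove (Set.range fun a : A.carrier => A.ballMeas d a) :=
  ⟨1, by rintro _ ⟨a, rfl⟩; exact A.ballMeas_le_one d a⟩

theorem iSup_ballMeas_nonneg (A : FinStruct L) (d : ℕ) : 0 ≤ ⨆ a : A.carrier, A.ballMeas d a :=
  Real.iSup_nonneg fun a => A.ballMeas_nonneg d a

theorem iSup_ballMeas_le_one (A : FinStruct L) (d : ℕ) : ⨆ a : A.carrier, A.ballMeas d a ≤ 1 :=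
  have := A.nonempty_carrier
  ciSup_le fun a => A.ballMeas_le_one d a

variable [L.IsRelational]

/-- The restriction to a set of positive measure. -/
def restrictPos (A : FinStruct L) (X : Set A.carrier) (h : 0 < A.meas X) : FinStruct L where
  carrier := inducedOn L X
  fintype := Fintype.ofFinite _
  weight := fun a => A.weight a / A.meas X
  weight_nonneg := fun a => div_nonneg (A.weight_nonneg _) h.le
  weight_sum := by
    classical
    let _ : Fintype (inducedOn L X) := Fintype.ofFinite _
    rw [← Finset.sum_div, div_eq_one_iff_eq h.ne', meas]
    exact (Finset.sum_subtype (Finset.univ.filter (· ∈ X)) (fun x => by simp; rfl) A.weight).symm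

theorem restrict_eq (A : FinStruct L) (X : Set A.carrier) (h : 0 < A.meas X) :
    A.restrict X = A.restrictPos X h :=
  dif_pos h

theorem meas_restrictPos (A : FinStruct L) (X : Set A.carrier) (h : 0 < A.meas X)
    (S : Set (inducedOn L X)) :
    (A.restrictPos X h).meas S = A.meas (inducedEmb L X '' S) / A.meas X := by
  classical
  let _ : Fintype (inducedOn L X) := Fintype.ofFinite _
  have h₁ : (A.restrictPos X h).meas S =
      ∑ a : inducedOn L X with a ∈ S, A.weight (a : A.carrier) / A.meas X := by
    rw [meas]
    congr 1
  rw [h₁, ← Finset.sum_div]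
  congr 1
  have h₂ : (Finset.univ.filter (· ∈ inducedEmb L X '' S)) =
      (Finset.univ.filter (· ∈ S)).image (inducedEmb L X) := by
    ext a
    simp only [Finset.mem_filter, Finset.mem_univ, true_and, Finset.mem_image, Set.mem_image]
  rw [meas, h₂, Finset.sum_image fun a _ b _ hab => (inducedEmb L X).injective hab]
  rfl

theorem ballMeas_restrictPos (A : FinStruct L) (X : Set A.carrier) (h : 0 < A.meas X) (d : ℕ)
    (a : inducedOn L X) : (A.restrictPos X h).ballMeas d a =
      A.meas (inducedEmb L X '' nbhd L d {a}) / A.meas X :=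
  A.meas_restrictPos X h _

/-- A large ball of the restricted structure serves as core: paths in the substructure are paths in
`A`, so its diameter in `A` is at most `d + d`. -/
theorem exists_core_of_lt_iSup (A : FinStruct L) {X : Set A.carrier} (h : 0 < A.meas X) {d : ℕ}
    {t : ℝ} (ht : t < ⨆ a : (A.restrict X).carrier, (A.restrict X).ballMeas d a) :
    ∃ K ⊆ X, (∀ a ∈ K, K ⊆ nbhd L (d + d) {a}) ∧ t * A.meas X ≤ A.meas K := by
  rw [A.restrict_eq X h] at ht
  have := (A.restrictPos X h).nonempty_carrier
  obtain ⟨(a : inducedOn L X), ha⟩ := exists_lt_of_lt_ciSup ht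
  replace ha := ha.trans_eq (A.ballMeas_restrictPos X h d a)
  refine ⟨inducedEmb L X '' nbhd L d {a}, ?_, ?_, ((lt_div_iff₀ h).1 ha).le⟩
  · rintro _ ⟨b, -, rfl⟩
    exact b.2
  · intro b hb c hc
    have hsub := image_nbhd_subset (inducedEmb L X) d {a}
    rw [Set.image_singleton] at hsub
    exact mem_nbhd_trans (mem_nbhd_singleton_comm.1 (hsub hb)) (hsub hc)

theorem le_iSup_ballMeas_restrict (A : FinStruct L) {X : Set A.carrier} (h : 0 < A.meas X) {d : ℕ}
    {w : A.carrier} (hw : nbhd L d {w} ⊆ X) :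
    A.ballMeas d w / A.meas X ≤ ⨆ a : (A.restrict X).carrier, (A.restrict X).ballMeas d a := by
  rw [A.restrict_eq X h]
  have hwX : w ∈ X := hw (subset_nbhd L d _ rfl)
  let w' : inducedOn L X := ⟨w, hwX⟩
  have heq := nbhd_image_eq (inducedEmb L X) (d := d) (X := {w'}) (by
    rw [Set.image_singleton, range_inducedEmb]
    exact hw)
  rw [Set.image_singleton] at heq
  refine le_trans (le_of_eq ?_) (le_ciSup ((A.restrictPos X h).bddAbove_ballMeas d) w')
  refine Eq.trans ?_ (A.ballMeas_restrictPos X h d w').symm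
  rw [← heq]
  rfl

end FinStruct

/-! ### Sets concentrated on balls of bounded radius -/

/-- Sets with negligible boundary and limit measure `l`, almost all of whose measure is
concentrated on subsets of bounded diameter. -/
structure GlobularLike (A : ℕ → FinStruct L) (X : ∀ n, Set (A n).carrier) (l : ℝ) : Prop where
  limit : HasLimitMeasure A X l
  boundary : Negligible A (fun n => outerBoundary L (X n))
  core : ∀ ε : ℝ, 0 < ε → ∃ d : ℕ, ∀ᶠ n in atTop, ∃ K ⊆ X n,
    (∀ a ∈ K, K ⊆ nbhd L d {a}) ∧ (A n).meas (X n) - ε ≤ (A n).meas K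

section GlobularLike

variable {A : ℕ → FinStruct L} {X : ∀ n, Set (A n).carrier} {l : ℝ}

theorem Negligible.eventually_lt (h : Negligible A X) (d : ℕ) {ε : ℝ} (hε : 0 < ε) :
    ∀ᶠ n in atTop, (A n).meas (nbhd L d (X n)) < ε :=
  (h d).eventually (gt_mem_nhds hε)

theorem HasLimitMeasure.eventually_abs_sub_lt (h : HasLimitMeasure A X l) {ε : ℝ} (hε : 0 < ε) :
    ∀ᶠ n in atTop, |(A n).meas (X n) - l| < ε :=
  Metric.tendsto_nhds.1 h ε hε

/-- Remove from a core of diameter `d₀` the points within `d` of the boundary, a set of small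
measure. The essential point is that `d₀` depends on `ε` only, while `d` is arbitrary: all radii
between `d₀` and `d` then give nearly the measure of `X n`. -/
theorem GlobularLike.exists_centres (h : GlobularLike A X l) {ε : ℝ} (hε : 0 < ε) :
    ∃ d₀ : ℕ, ∀ d : ℕ, ∀ᶠ n in atTop, ∃ K ⊆ X n, (A n).meas (X n) - ε ≤ (A n).meas K ∧
      ∀ w ∈ K, nbhd L d {w} ⊆ X n ∧ (A n).meas (X n) - ε ≤ (A n).ballMeas d₀ w := by
  obtain ⟨d₀, hd₀⟩ := h.core (ε / 2) (by positivity)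
  refine ⟨d₀, fun d => ?_⟩
  filter_upwards [hd₀, h.boundary.eventually_lt d (half_pos hε)] with n ⟨K, hKX, hK, hKm⟩ hn
  refine ⟨K \ nbhd L d (outerBoundary L (X n)), Set.sdiff_subset.trans hKX, ?_, fun w hw => ⟨?_, ?_⟩⟩
  · have := (A n).meas_le_add (X := K) (Y := K \ nbhd L d (outerBoundary L (X n)))
      (Z := nbhd L d (outerBoundary L (X n))) (by
        intro a ha
        by_cases h : a ∈ nbhd L d (outerBoundary L (X n))
        · exact Or.inr h
        · exact Or.inl ⟨ha, h⟩)
    linarith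
  · exact nbhd_subset_of_notMem (hKX hw.1) hw.2
  · have := (A n).meas_mono (hK w hw.1)
    rw [FinStruct.ballMeas]
    linarith

/-- Choosing at each stage among finitely many sequences. -/
theorem GlobularLike.select {m : ℕ} {C : Fin m → ∀ n, Set (A n).carrier}
    (h : ∀ i, GlobularLike A (C i) l) (π : ℕ → Fin m) :
    GlobularLike A (fun n => C (π n) n) l where
  limit := Metric.tendsto_nhds.2 fun ε hε => by
    filter_upwards [eventually_all.2 fun i => Metric.tendsto_nhds.1 (h i).limit ε hε] with n hn
    exact hn (π n)
  boundary := fun d => Metric.tendsto_nhds.2 fun ε hε => by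
    filter_upwards [eventually_all.2 fun i => Metric.tendsto_nhds.1 ((h i).boundary d) ε hε]
      with n hn
    exact hn (π n)
  core := fun ε hε => by
    choose d hd using fun i => (h i).core ε hε
    refine ⟨Finset.univ.sup d, ?_⟩
    filter_upwards [eventually_all.2 hd] with n hn
    obtain ⟨K, hKX, hK, hKm⟩ := hn (π n)
    exact ⟨K, hKX, fun a ha => (hK a ha).trans
      (nbhd_mono_radius (Finset.le_sup (Finset.mem_univ (π n))) _), hKm⟩

theorem GlobularLike.not_negligible (h : GlobularLike A X l) (hl : 0 < l) : ¬ Negligible A X := by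
  intro hX
  have h₁ := hX 0
  simp only [nbhd_zero] at h₁
  exact hl.ne' (tendsto_nhds_unique h.limit h₁)

theorem isBoundedUnder_ge_iSup_ballMeas (B : ℕ → FinStruct L) (d : ℕ) :
    IsBoundedUnder (· ≥ ·) atTop (fun n => ⨆ a : (B n).carrier, (B n).ballMeas d a) :=
  isBoundedUnder_of ⟨0, fun n => (B n).iSup_ballMeas_nonneg d⟩

theorem isCoboundedUnder_ge_iSup_ballMeas (B : ℕ → FinStruct L) (d : ℕ) :
    IsCoboundedUnder (· ≥ ·) atTop (fun n => ⨆ a : (B n).carrier, (B n).ballMeas d a) :=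
  IsBoundedUnder.isCoboundedUnder_ge (isBoundedUnder_of ⟨1, fun n => (B n).iSup_ballMeas_le_one d⟩)

variable [L.IsRelational]

theorem IsGlobular.globularLike (h : IsGlobular A X) (hl : 0 < l) (hX : HasLimitMeasure A X l) :
    GlobularLike A X l where
  limit := hX
  boundary := h.cluster.boundary
  core := fun ε hε => by
    obtain ⟨d, hd⟩ := h.nonDispersive ε hε
    refine ⟨d + d, ?_⟩
    filter_upwards [eventually_lt_of_lt_liminf hd (isBoundedUnder_ge_iSup_ballMeas _ d),
      hX.eventually (lt_mem_nhds hl)] with n hn hpos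
    obtain ⟨K, hKX, hK, hKm⟩ := (A n).exists_core_of_lt_iSup hpos hn
    refine ⟨K, hKX, hK, le_trans ?_ hKm⟩
    nlinarith [(A n).meas_le_one (X n)]

theorem GlobularLike.nonDispersive (h : GlobularLike A X l) (hl : 0 < l) :
    NonDispersive (fun n => (A n).restrict (X n)) := by
  intro ε hε
  -- The bound `ε / 2` makes the final inequality strict; `1 / 2` keeps the set of centres nonempty.
  -- The tolerance `η * (l / 2)` below is a relative error `η`, as `X n` eventually has measure
  -- above `l / 2`.
  set η := min (ε / 2) (1 / 2) with hη
  have hη0 : 0 < η := lt_min (by positivity) (by norm_num)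
  obtain ⟨d, hd⟩ := h.exists_centres (show 0 < η * (l / 2) by positivity)
  refine ⟨d, lt_of_lt_of_le (b := 1 - η) ?_
    (le_liminf_of_le (isCoboundedUnder_ge_iSup_ballMeas _ d) ?_)⟩
  · linarith [min_le_left (ε / 2) (1 / 2)]
  filter_upwards [hd d, h.limit.eventually (lt_mem_nhds (half_lt_self hl))]
    with n ⟨K, hKX, hKm, hK⟩ hpos
  have hX0 : 0 < (A n).meas (X n) := (half_pos hl).trans hpos
  have hη1 : η ≤ 1 / 2 := min_le_right _ _
  have hle : η * (l / 2) ≤ η * (A n).meas (X n) := mul_le_mul_of_nonneg_left hpos.le hη0.le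
  have hK0 : 0 < (A n).meas K := by nlinarith
  obtain ⟨w, hw⟩ : K.Nonempty := by
    rw [Set.nonempty_iff_ne_empty]
    rintro rfl
    simp at hK0
  obtain ⟨hwX, hwm⟩ := hK w hw
  refine le_trans ?_ ((A n).le_iSup_ballMeas_restrict hX0 hwX)
  rw [le_div_iff₀ hX0]
  linarith

end GlobularLike

/-! ### The upper bound on the number of globular clusters -/

theorem FinStruct.sum_meas_le_of_disjoint (A : FinStruct L) {k : ℕ} {K : Fin k → Set A.carrier}
    (hK : ∀ i j, i ≠ j → Disjoint (K i) (K j)) {f : A.carrier → ℝ} (hf : ∀ w, 0 ≤ f w)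
    (hfK : ∀ i, ∀ w ∈ K i, 1 ≤ f w) : ∑ i, A.meas (K i) ≤ ∑ w, A.weight w * f w := by
  classical
  simp only [meas_eq_sum_ite]
  rw [Finset.sum_comm]
  refine Finset.sum_le_sum fun w _ => ?_
  by_cases hw : ∃ i, w ∈ K i
  · obtain ⟨i, hi⟩ := hw
    rw [Finset.sum_eq_single i]
    · rw [if_pos hi]
      exact le_mul_of_one_le_right (A.weight_nonneg w) (hfK i w hi)
    · intro j _ hji
      exact if_neg fun hj => Set.disjoint_left.1 (hK j i hji) hj hi
    · simp
  · push Not at hw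
    rw [Finset.sum_eq_zero fun i _ => if_neg (hw i)]
    exact mul_nonneg (A.weight_nonneg w) (hf w)

theorem mul_le_of_globularLike {A : ℕ → FinStruct L} {P : ProbabilityMeasure ℝ}
    (hP : IsSpectrum A P) {l : ℝ} {k : ℕ} {G : Fin k → ∀ n, Set (A n).carrier}
    (hG : ∀ i, GlobularLike A (G i) l)
    (hdisj : ∀ i j, i ≠ j → Negligible A (fun n => G i n ∩ G j n)) :
    k * l ≤ (P : Measure ℝ).real {l} := by
  by_contra! hlt
  set p := (P : Measure ℝ).real {l} with hp
  set δ := k * l - p with hδ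
  have hδ0 : 0 < δ := sub_pos.2 hlt
  obtain ⟨ε₁, hε₁, hbump⟩ := exists_integral_bump_lt P l (show 0 < δ / 4 by positivity)
  -- The `k` sets of centres lose `(2 + k) * ε` each; the summand `1` only keeps `c` positive when
  -- `k = 0`.
  set c : ℝ := 2 * k + k * k + 1 with hc
  have hc0 : 0 < c := by positivity
  set ε := min (ε₁ / 2) (δ / 4 / c) with hε
  have hε0 : 0 < ε := lt_min (by positivity) (by positivity)
  have hεc : ε * c ≤ δ / 4 := (le_div_iff₀ hc0).1 (min_le_right _ _)
  have hε1 : ε ≤ ε₁ / 2 := min_le_left _ _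
  choose d₀ hd₀ using fun i => (hG i).exists_centres hε0
  obtain ⟨d, hd, hdle⟩ := ((hP.eventually (bump l ε₁) (show 0 < δ / 4 by positivity)).and
    (eventually_ge_atTop (Finset.univ.sup d₀))).exists
  have hev := (hd.and (eventually_all.2 fun i => hd₀ i d)).and
    ((eventually_all.2 fun i => (hG i).limit.eventually_abs_sub_lt hε0).and
      (eventually_all.2 fun i => eventually_all.2 fun j => eventually_all.2 fun hij : i ≠ j =>
        (hdisj i j hij).eventually_lt 0 hε0))
  obtain ⟨n, ⟨hsum, hcent⟩, hlim, hint⟩ := hev.exists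
  simp only [nbhd_zero] at hint
  choose K hKX hKm hK using hcent
  -- Deleting the overlaps makes the sets of centres disjoint, at a cost of at most `k * ε` each.
  let K' : Fin k → Set (A n).carrier := fun i =>
    K i \ ⋃ j ∈ Finset.univ.erase i, (G i n ∩ G j n)
  have hK'm : ∀ i, l - (2 + k) * ε ≤ (A n).meas (K' i) := by
    intro i
    have h₁ := (A n).meas_le_add (X := K i) (Y := K' i)
      (Z := ⋃ j ∈ Finset.univ.erase i, (G i n ∩ G j n)) (by
        intro a ha
        by_cases h : a ∈ ⋃ j ∈ Finset.univ.erase i, (G i n ∩ G j n)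
        · exact Or.inr h
        · exact Or.inl ⟨ha, h⟩)
    have h₂ := (A n).meas_iUnion_le (Finset.univ.erase i) (fun j => G i n ∩ G j n)
    have h₃ : ∑ j ∈ Finset.univ.erase i, (A n).meas (G i n ∩ G j n) ≤ k * ε := by
      refine (Finset.sum_le_card_nsmul _ _ ε fun j hj =>
        (hint i j (Finset.ne_of_mem_erase hj).symm).le).trans ?_
      rw [nsmul_eq_mul]
      refine mul_le_mul_of_nonneg_right ?_ hε0.le
      have := Finset.card_le_univ (Finset.univ.erase i)
      rw [Fintype.card_fin] at this
      exact_mod_cast this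
    have h₄ := abs_lt.1 (hlim i)
    have h₅ := hKm i
    linarith
  have hKdisj : ∀ i j, i ≠ j → Disjoint (K' i) (K' j) := by
    intro i j hij
    rw [Set.disjoint_left]
    intro a hai haj
    refine hai.2 (Set.mem_iUnion₂.2 ⟨j, ?_, hKX i hai.1, hKX j haj.1⟩)
    exact Finset.mem_erase.2 ⟨hij.symm, Finset.mem_univ j⟩
  have hlow := (A n).sum_meas_le_of_disjoint hKdisj
    (f := fun w => bump l ε₁ ((A n).ballMeas d w)) (fun w => bump_nonneg _ _ _) (by
      intro i w hw
      obtain ⟨hwX, hwm⟩ := hK i w hw.1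
      refine (bump_eq_one hε₁ ?_).ge
      have h₁ := (A n).ballMeas_mono ((Finset.le_sup (Finset.mem_univ i)).trans hdle) w
      have h₂ := (A n).meas_mono hwX
      have h₃ := abs_lt.1 (hlim i)
      rw [← FinStruct.ballMeas] at h₂
      rw [abs_le]
      constructor <;> linarith)
  have h₁ : k * (l - (2 + k) * ε) ≤ ∑ i, (A n).meas (K' i) := by
    have := Finset.card_nsmul_le_sum Finset.univ (fun i => (A n).meas (K' i)) _
      fun i _ => hK'm i
    simpa using this
  have h₂ := abs_lt.1 hsum
  have h₃ : (2 * k + k * k) * ε ≤ δ / 4 := by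
    refine le_trans ?_ hεc
    rw [hc]
    nlinarith
  nlinarith

end Globular

section Construction

variable {L : FirstOrder.Language.{u, v}}

/-! ### Construction of the clusters -/

/-- Take for `κ n` the largest `k ≤ n` whose threshold has been passed at time `n`. -/
theorem exists_diagonal {Q : ℕ → ℕ → Prop} (h : ∀ k, ∀ᶠ n in atTop, Q k n) :
    ∃ κ : ℕ → ℕ, Tendsto κ atTop atTop ∧ ∀ᶠ n in atTop, Q (κ n) n := by
  classical
  choose N hN using fun k => eventually_atTop.1 (h k)
  refine ⟨fun n => Nat.findGreatest (fun k => N k ≤ n) n, ?_, ?_⟩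
  · refine tendsto_atTop.2 fun k => ?_
    filter_upwards [eventually_ge_atTop (max k (N k))] with n hn
    exact Nat.le_findGreatest ((le_max_left _ _).trans hn) ((le_max_right _ _).trans hn)
  · filter_upwards [eventually_ge_atTop (N 0)] with n hn
    exact hN _ n (Nat.findGreatest_spec (P := fun k => N k ≤ n) (Nat.zero_le n) hn)

/-- Greedy choice: each point chosen forbids a ball of measure at most `c`, and `(m - 1) * c` does
not exhaust `S`. -/
theorem FinStruct.exists_separated (A : FinStruct L) {S : Set A.carrier} {D : ℕ} {c : ℝ}
    (hc0 : 0 ≤ c) (hc : ∀ w ∈ S, A.ballMeas D w ≤ c) (m : ℕ) (hm : m * c < A.meas S + c) :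
    ∃ w : Fin m → A.carrier, (∀ i, w i ∈ S) ∧ ∀ i j, i ≠ j → w j ∉ nbhd L D {w i} := by
  induction m with
  | zero => exact ⟨Fin.elim0, fun i => i.elim0, fun i => i.elim0⟩
  | succ m ih =>
    push_cast at hm
    obtain ⟨w, hwS, hw⟩ := ih (by linarith)
    obtain ⟨s, hsS, hs⟩ : ∃ s ∈ S, s ∉ ⋃ i ∈ Finset.univ, nbhd L D {w i} := by
      by_contra! hcon
      have h₁ := A.meas_mono (X := S) hcon
      have h₂ := A.meas_iUnion_le Finset.univ (fun i => nbhd L D {w i})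
      have h₃ := Finset.sum_le_card_nsmul Finset.univ (fun i => A.meas (nbhd L D {w i})) c
        fun i _ => hc _ (hwS i)
      rw [nsmul_eq_mul, Finset.card_univ, Fintype.card_fin] at h₃
      linarith
    simp only [Set.mem_iUnion, Finset.mem_univ, exists_prop, true_and, not_exists] at hs
    refine ⟨Fin.cons s w, fun i => ?_, fun i j hij => ?_⟩
    · refine Fin.cases ?_ (fun i => ?_) i
      · exact hsS
      · exact hwS i
    · rcases Fin.eq_zero_or_eq_succ i with rfl | ⟨i, rfl⟩ <;>
        rcases Fin.eq_zero_or_eq_succ j with rfl | ⟨j, rfl⟩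
      · exact absurd rfl hij
      · rw [Fin.cons_zero, Fin.cons_succ, mem_nbhd_singleton_comm]
        exact hs j
      · rw [Fin.cons_zero, Fin.cons_succ]
        exact hs i
      · rw [Fin.cons_succ, Fin.cons_succ]
        exact hw i j fun h => hij (congrArg _ h)

variable {A : ℕ → FinStruct L} {P : ProbabilityMeasure ℝ}

/-- From some radius on, the expected growth of balls is small. -/
theorem IsSpectrum.exists_radius (hP : IsSpectrum A P) {η : ℝ} (hη : 0 < η) :
    ∃ d : ℕ, ∀ e ≥ d, ∀ᶠ n in atTop,
      ∑ w, (A n).weight w * ((A n).ballMeas e w - (A n).ballMeas d w) < η := by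
  -- The growth is a difference of first moments; the identity is clamped to be an admissible
  -- bounded test function.
  obtain ⟨d, hd⟩ := eventually_atTop.1
    (hP.eventually (clamped (ContinuousMap.id ℝ)) (half_pos hη))
  refine ⟨d, fun e he => ?_⟩
  filter_upwards [hd d le_rfl, hd e he] with n h₁ h₂
  have hcl : ∀ (r : ℕ) (w : (A n).carrier),
      clamped (ContinuousMap.id ℝ) ((A n).ballMeas r w) = (A n).ballMeas r w := fun r w => by
    rw [clamped_apply, clamp_eq ⟨(A n).ballMeas_nonneg r w, (A n).ballMeas_le_one r w⟩]
    rfl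
  simp only [hcl] at h₁ h₂
  simp only [mul_sub, Finset.sum_sub_distrib]
  linarith [abs_lt.1 h₁, abs_lt.1 h₂]

/-- Start from the points whose `e`-ball has measure near `l`, of total mass at least that of the
atom minus `δ`. By Markov, those whose ball grows by `(1 / 2) ^ j` or more after radius `r j` have
mass at most `δ * (1 / 2) ^ j`, which explains the squared power in `hr`; altogether `2 * δ` is
lost. The rest has enough mass for `m` greedy choices. -/
theorem IsSpectrum.exists_stage (hP : IsSpectrum A P) {l θ δ : ℝ} (hl : 0 < l) (hθ : 0 < θ)
    (hδ : 0 < δ) {m : ℕ} (hm : m * (l + θ) + 3 * δ < (P : Measure ℝ).real {l} + (l + θ))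
    {r : ℕ → ℕ} (hr : ∀ j, ∀ e ≥ r j, ∀ᶠ n in atTop,
      ∑ w, (A n).weight w * ((A n).ballMeas e w - (A n).ballMeas (r j) w) <
        δ * (1 / 2) ^ j * (1 / 2) ^ j) (k : ℕ) :
    ∃ R : ℕ, (∀ j ≤ k, r j + k ≤ R) ∧ ∀ᶠ n in atTop, ∃ w : Fin m → (A n).carrier,
      (∀ i j, i ≠ j → Disjoint (nbhd L R {w i}) (nbhd L R {w j})) ∧
      ∀ i, (A n).ballMeas (R + k + 1) (w i) ≤ l + θ / (k + 1) ∧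
        ∀ j ≤ k, l - θ / (k + 1) - (1 / 2) ^ j ≤ (A n).ballMeas (r j) (w i) := by
  -- The sum dominates each `r j`; the extra `k` leaves room for `k`-neighbourhoods of the boundary
  -- outside the ball of radius `r k`.
  set R := ∑ j ∈ Finset.range (k + 1), r j + k with hR
  have hrR : ∀ j ≤ k, r j + k ≤ R := fun j hj => by
    have := Finset.single_le_sum (f := r) (fun _ _ => Nat.zero_le _)
      (Finset.mem_range.2 (Nat.lt_succ_of_le hj) : j ∈ Finset.range (k + 1))
    omega
  have hθk : 0 < θ / (k + 1) := by positivity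
  have hθle : θ / (k + 1) ≤ θ := div_le_self hθ.le (by linarith [Nat.cast_nonneg (α := ℝ) k])
  refine ⟨R, hrR, ?_⟩
  -- The radius `e` must exceed `R + R`, for separation, and `R + k + 1`, for the upper bound on
  -- balls.
  obtain ⟨e, he, hle⟩ := ((hP.eventually (bump l (θ / (k + 1) / 2)) hδ).and
    (eventually_ge_atTop (R + R + k + 1))).exists
  have hr' : ∀ᶠ n in atTop, ∀ j ∈ Finset.range (k + 1),
      ∑ w, (A n).weight w * ((A n).ballMeas e w - (A n).ballMeas (r j) w) <
        δ * (1 / 2) ^ j * (1 / 2) ^ j := by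
    refine (Finset.eventually_all _).2 fun j hj => hr j e ?_
    have := hrR j (Nat.lt_succ_iff.1 (Finset.mem_range.1 hj))
    omega
  filter_upwards [he, hr'] with n hn hbad
  have hp := le_integral_bump P l (half_pos hθk)
  set W : Set (A n).carrier := {w | |(A n).ballMeas e w - l| < θ / (k + 1)} with hW
  have hWm : (P : Measure ℝ).real {l} - δ ≤ (A n).meas W := by
    have h₁ := (A n).sum_le_meas (X := W)
      (f := fun w => bump l (θ / (k + 1) / 2) ((A n).ballMeas e w)) (fun w => bump_le_one _ _ _)
      fun w hw => bump_eq_zero (half_pos hθk) (by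
        rw [hW, Set.mem_ofPred_eq, not_lt] at hw
        linarith)
    linarith [(abs_lt.1 hn).1]
  set B : ℕ → Set (A n).carrier := fun j =>
    {w | (1 / 2) ^ j ≤ (A n).ballMeas e w - (A n).ballMeas (r j) w} with hB
  have hBm : ∀ j ∈ Finset.range (k + 1), (A n).meas (B j) ≤ δ * (1 / 2) ^ j := by
    intro j hj
    have hj' := hrR j (Nat.lt_succ_iff.1 (Finset.mem_range.1 hj))
    have h₁ := (A n).meas_mul_le_sum (X := B j) (t := (1 / 2) ^ j)
      (f := fun w => (A n).ballMeas e w - (A n).ballMeas (r j) w)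
      (fun w => sub_nonneg.2 ((A n).ballMeas_mono (by omega) w)) fun w hw => hw
    exact le_of_mul_le_mul_right (h₁.trans (hbad j hj).le) (by positivity)
  have hBU : (A n).meas (⋃ j ∈ Finset.range (k + 1), B j) ≤ 2 * δ := by
    refine ((A n).meas_iUnion_le _ B).trans ((Finset.sum_le_sum hBm).trans ?_)
    rw [← Finset.mul_sum, mul_comm]
    exact mul_le_mul_of_nonneg_right (sum_geometric_two_le _) hδ.le
  set S := W \ ⋃ j ∈ Finset.range (k + 1), B j with hS
  have hSm : (P : Measure ℝ).real {l} - 3 * δ ≤ (A n).meas S := by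
    have := (A n).meas_le_add (X := W) (Y := S) (Z := ⋃ j ∈ Finset.range (k + 1), B j) (by
      rw [hS, Set.sdiff_union_self]
      exact Set.subset_union_left)
    linarith
  have hSball : ∀ d ≤ e, ∀ w ∈ S, (A n).ballMeas d w ≤ l + θ / (k + 1) := fun d hd w hw => by
    have hwW : |(A n).ballMeas e w - l| < θ / (k + 1) := hw.1
    linarith [(A n).ballMeas_mono hd w, (abs_lt.1 hwW).2]
  obtain ⟨w, hwS, hw⟩ := (A n).exists_separated (S := S) (D := R + R) (c := l + θ) (by positivity)
    (fun w hw => (hSball _ (by omega) w hw).trans (by linarith)) m (by linarith)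
  refine ⟨w, fun i j hij => ?_, fun i => ⟨hSball _ (by omega) _ (hwS i), fun j hj => ?_⟩⟩
  · rw [Set.disjoint_left]
    intro a hi hj
    exact hw i j hij (mem_nbhd_trans hi (mem_nbhd_singleton_comm.1 hj))
  · have hwW : |(A n).ballMeas e (w i) - l| < θ / (k + 1) := (hwS i).1
    have h₁ := (abs_lt.1 hwW).1
    have h₂ : w i ∉ B j := fun h => (hwS i).2
      (Set.mem_iUnion₂.2 ⟨j, Finset.mem_range.2 (Nat.lt_succ_of_le hj), h⟩)
    rw [hB, Set.mem_ofPred_eq, not_le] at h₂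
    linarith

theorem IsSpectrum.exists_globularLike (hP : IsSpectrum A P) {l : ℝ} (hl : 0 < l) {m : ℕ}
    (hm : m * l < (P : Measure ℝ).real {l} + l) :
    ∃ C : Fin m → ∀ n, Set (A n).carrier, (∀ i, GlobularLike A (C i) l) ∧
      ∀ i j, i ≠ j → ∀ n, Disjoint (C i n) (C j n) := by
  set δ := ((P : Measure ℝ).real {l} + l - m * l) / 4 with hδ
  have hδ0 : 0 < δ := div_pos (by linarith) (by norm_num)
  set θ := δ / (m + 1) with hθ
  have hθ0 : 0 < θ := by positivity
  have hθm : θ * (m + 1) = δ := div_mul_cancel₀ _ (by positivity)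
  choose r hr using fun j : ℕ => hP.exists_radius
    (show 0 < δ * (1 / 2) ^ j * (1 / 2) ^ j by positivity)
  choose R hR hstage using hP.exists_stage (m := m) hl hθ0 hδ0 (by nlinarith) hr
  obtain ⟨κ, hκ, hev⟩ := exists_diagonal hstage
  have hC : ∀ n, ∃ C : Fin m → Set (A n).carrier, (∀ i j, i ≠ j → Disjoint (C i) (C j)) ∧
      ((∃ w : Fin m → (A n).carrier,
        (∀ i j, i ≠ j → Disjoint (nbhd L (R (κ n)) {w i}) (nbhd L (R (κ n)) {w j})) ∧
        ∀ i, (A n).ballMeas (R (κ n) + κ n + 1) (w i) ≤ l + θ / (κ n + 1) ∧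
        ∀ j ≤ κ n, l - θ / (κ n + 1) - (1 / 2) ^ j ≤ (A n).ballMeas (r j) (w i)) →
      ∀ i, ∃ w, C i = nbhd L (R (κ n)) {w} ∧
        (A n).ballMeas (R (κ n) + κ n + 1) w ≤ l + θ / (κ n + 1) ∧
        ∀ j ≤ κ n, l - θ / (κ n + 1) - (1 / 2) ^ j ≤ (A n).ballMeas (r j) w) := by
    intro n
    by_cases h : ∃ w : Fin m → (A n).carrier,
        (∀ i j, i ≠ j → Disjoint (nbhd L (R (κ n)) {w i}) (nbhd L (R (κ n)) {w j})) ∧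
        ∀ i, (A n).ballMeas (R (κ n) + κ n + 1) (w i) ≤ l + θ / (κ n + 1) ∧
        ∀ j ≤ κ n, l - θ / (κ n + 1) - (1 / 2) ^ j ≤ (A n).ballMeas (r j) (w i)
    · obtain ⟨w, hw, hw'⟩ := h
      exact ⟨fun i => nbhd L (R (κ n)) {w i}, hw, fun _ i => ⟨w i, rfl, hw' i⟩⟩
    -- Empty sets at the finitely many `n` where the stage fails keep disjointness valid for every
    -- `n`.
    · exact ⟨fun _ => ∅, fun _ _ _ => disjoint_bot_left, fun h' => absurd h' h⟩
  choose C hCd hCw using hC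
  have hpow : Tendsto (fun k : ℕ => (1 / 2 : ℝ) ^ k) atTop (𝓝 0) :=
    tendsto_pow_atTop_nhds_zero_of_lt_one (by norm_num) (by norm_num)
  have herr : Tendsto (fun n => θ / ((κ n : ℝ) + 1) + (1 / 2) ^ (κ n)) atTop (𝓝 0) := by
    have h₁ : Tendsto (fun k : ℕ => θ / ((k : ℝ) + 1)) atTop (𝓝 0) :=
      tendsto_const_nhds.div_atTop (tendsto_atTop_add_const_right _ 1 tendsto_natCast_atTop_atTop)
    have h₂ := (h₁.add hpow).comp hκ
    rwa [add_zero] at h₂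
  have hhalf : ∀ k : ℕ, (0 : ℝ) < (1 / 2) ^ k := fun k => by positivity
  refine ⟨fun i n => C n i, fun i => ⟨?_, fun d => ?_, fun ε hε => ?_⟩,
    fun i j hij n => hCd n i j hij⟩
  · refine Metric.tendsto_nhds.2 fun ε hε => ?_
    filter_upwards [hev, herr.eventually (gt_mem_nhds hε)] with n hn hnε
    obtain ⟨w, hw, hup, hlow⟩ := hCw n hn i
    have h₁ := (A n).ballMeas_mono (show R (κ n) ≤ R (κ n) + κ n + 1 by omega) w
    have h₂ := (A n).ballMeas_mono (show r (κ n) ≤ R (κ n) by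
      have := hR (κ n) (κ n) le_rfl; omega) w
    have h₃ := hlow (κ n) le_rfl
    have h₄ := hhalf (κ n)
    rw [hw, Real.dist_eq, abs_lt]
    change -ε < (A n).ballMeas (R (κ n)) w - l ∧ (A n).ballMeas (R (κ n)) w - l < ε
    constructor <;> linarith
  · refine Metric.tendsto_nhds.2 fun ε hε => ?_
    filter_upwards [hev, herr.eventually (gt_mem_nhds (half_pos hε)),
      hκ.eventually_ge_atTop d] with n hn hnε hnd
    obtain ⟨w, hw, hup, hlow⟩ := hCw n hn i
    have hRκ := hR (κ n) (κ n) le_rfl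
    have hsub : nbhd L d (outerBoundary L (C n i)) ⊆
        nbhd L (R (κ n) + κ n + 1) {w} \ nbhd L (r (κ n)) {w} := by
      intro y hy
      obtain ⟨z, ⟨hz, hzC⟩, hyz⟩ := mem_nbhd_iff.1 hy
      rw [hw] at hz hzC
      have hz' := nbhd_nbhd_subset _ _ _ hz
      refine ⟨nbhd_mono_radius (by omega) _ (mem_nbhd_trans hz' hyz), fun hyr => hzC ?_⟩
      exact nbhd_mono_radius (by omega) _ (mem_nbhd_trans hyr (mem_nbhd_singleton_comm.1 hyz))
    have h₁ := (A n).meas_mono hsub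
    rw [(A n).meas_diff (nbhd_mono_radius (by omega) _)] at h₁
    have h₃ := hlow (κ n) le_rfl
    have h₄ := hhalf (κ n)
    rw [FinStruct.ballMeas] at hup h₃
    rw [Real.dist_eq, sub_zero, abs_of_nonneg ((A n).meas_nonneg _)]
    linarith
  · obtain ⟨j, hj⟩ := (hpow.eventually (gt_mem_nhds (half_pos hε))).exists
    refine ⟨r j + r j, ?_⟩
    filter_upwards [hev, herr.eventually (gt_mem_nhds (show 0 < ε / 4 by positivity)),
      hκ.eventually_ge_atTop j] with n hn hnε hnj
    obtain ⟨w, hw, hup, hlow⟩ := hCw n hn i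
    have hRκ := hR (κ n) j hnj
    refine ⟨nbhd L (r j) {w}, ?_, fun a ha b hb =>
      mem_nbhd_trans (mem_nbhd_singleton_comm.1 ha) hb, ?_⟩
    · rw [hw]
      exact nbhd_mono_radius (by omega) _
    · have h₁ := (A n).ballMeas_mono (show R (κ n) ≤ R (κ n) + κ n + 1 by omega) w
      have h₃ := hlow j hnj
      have h₄ := hhalf (κ n)
      rw [hw]
      change (A n).ballMeas (R (κ n)) w - ε ≤ (A n).ballMeas (r j) w
      linarith

end Construction

/-! ### Relabelling finitely many sequences with convergent power sums -/

section Relabel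

variable {ι : Type*} {m : ℕ}

/-- The power sum of a family of points associated with a monomial. -/
def powerSum (x : Fin m → ι → ℝ) (e : ι →₀ ℕ) : ℝ :=
  ∑ i, e.prod fun j k => x i j ^ k

theorem sum_eval_eq_of_powerSum_eq {a b : Fin m → ι → ℝ} (h : ∀ e, powerSum a e = powerSum b e)
    (q : MvPolynomial ι ℝ) :
    ∑ i, MvPolynomial.eval (a i) q = ∑ i, MvPolynomial.eval (b i) q := by
  induction q using MvPolynomial.induction_on' with
  | monomial e c =>
    simp only [MvPolynomial.eval_monomial, ← Finset.mul_sum]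
    exact congrArg (c * ·) (h e)
  | add p q hp hq => simp only [map_add, Finset.sum_add_distrib, hp, hq]

theorem exists_eval_eq_indicator (T : Finset (ι → ℝ)) (z : ι → ℝ) [DecidableEq (ι → ℝ)] :
    ∃ q : MvPolynomial ι ℝ, ∀ y ∈ T, MvPolynomial.eval y q = if y = z then 1 else 0 := by
  have h : ∀ y : ι → ℝ, ∃ q : MvPolynomial ι ℝ, MvPolynomial.eval z q = 1 ∧
      (y ≠ z → MvPolynomial.eval y q = 0) := by
    intro y
    by_cases hy : y = z
    · exact ⟨1, by simp, fun h => absurd hy h⟩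
    · obtain ⟨j, hj⟩ := Function.ne_iff.1 hy
      refine ⟨MvPolynomial.C (z j - y j)⁻¹ * (MvPolynomial.X j - MvPolynomial.C (y j)), ?_, ?_⟩
      · simpa using inv_mul_cancel₀ (sub_ne_zero.2 (Ne.symm hj))
      · simp
  choose q hq₁ hq₂ using h
  refine ⟨∏ y ∈ T, q y, fun y hy => ?_⟩
  rw [map_prod]
  split_ifs with hyz
  · subst hyz
    exact Finset.prod_eq_one fun y' _ => hq₁ y'
  · exact Finset.prod_eq_zero hy (hq₂ y hyz)

theorem exists_perm_of_powerSum_eq {a b : Fin m → ι → ℝ} (h : ∀ e, powerSum a e = powerSum b e) :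
    ∃ σ : Equiv.Perm (Fin m), ∀ i, b (σ i) = a i := by
  classical
  have hcard : ∀ z, Fintype.card {i // a i = z} = Fintype.card {i // b i = z} := by
    intro z
    obtain ⟨q, hq⟩ := exists_eval_eq_indicator (Finset.univ.image a ∪ Finset.univ.image b) z
    have hs := sum_eval_eq_of_powerSum_eq h q
    rw [Finset.sum_congr rfl fun i _ => hq (a i) (Finset.mem_union_left _
        (Finset.mem_image_of_mem a (Finset.mem_univ i))),
      Finset.sum_congr rfl fun i _ => hq (b i) (Finset.mem_union_right _
        (Finset.mem_image_of_mem b (Finset.mem_univ i))),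
      Finset.sum_boole, Finset.sum_boole] at hs
    rw [Fintype.card_subtype, Fintype.card_subtype]
    exact_mod_cast hs
  exact ⟨Equiv.ofFiberEquiv fun z => Fintype.equivOfCardEq (hcard z),
    fun i => Equiv.ofFiberEquiv_map _ i⟩

theorem continuous_powerSum (e : ι →₀ ℕ) :
    Continuous fun x : Fin m → ι → ℝ => powerSum x e := by
  unfold powerSum Finsupp.prod
  fun_prop

theorem exists_relabelling [Countable ι] {s : ℕ → Fin m → ι → ℝ}
    (hs : ∀ n i j, s n i j ∈ Set.Icc (0 : ℝ) 1)
    (h : ∀ e, ∃ l, Tendsto (fun n => powerSum (s n) e) atTop (𝓝 l)) :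
    ∃ π : ℕ → Equiv.Perm (Fin m), ∀ i j, ∃ l, Tendsto (fun n => s n (π n i) j) atTop (𝓝 l) := by
  choose l hl using h
  let _ : MetricSpace (Fin m → ι → ℝ) := TopologicalSpace.metrizableSpaceMetric _
  have hcomp : IsCompact (Set.univ.pi fun _ : Fin m => Set.univ.pi fun _ : ι =>
      Set.Icc (0 : ℝ) 1) :=
    isCompact_univ_pi fun _ => isCompact_univ_pi fun _ => isCompact_Icc
  have hmem : ∀ n, s n ∈ (Set.univ.pi fun _ : Fin m => Set.univ.pi fun _ : ι =>
      Set.Icc (0 : ℝ) 1) := fun n i _ j _ => hs n i j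
  have hlim : ∀ {ns : ℕ → ℕ} {b : Fin m → ι → ℝ}, Tendsto ns atTop atTop →
      Tendsto (fun k => s (ns k)) atTop (𝓝 b) → ∀ e, powerSum b e = l e := fun hns hb e =>
    tendsto_nhds_unique (((continuous_powerSum e).tendsto _).comp hb) ((hl e).comp hns)
  obtain ⟨a, -, ψ, hψ, ha⟩ := hcomp.tendsto_subseq hmem
  have hae := hlim hψ.tendsto_atTop ha
  choose π hπ using fun n => Finite.exists_min
    fun σ : Equiv.Perm (Fin m) => dist (fun i => s n (σ i)) a
  have hconv : Tendsto (fun n => fun i => s n (π n i)) atTop (𝓝 a) := by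
    refine tendsto_of_subseq_tendsto fun ns hns => ?_
    obtain ⟨b, -, ms, hms, hb⟩ := hcomp.tendsto_subseq fun k => hmem (ns k)
    obtain ⟨σ, hσ⟩ := exists_perm_of_powerSum_eq (a := a) (b := b) fun e =>
      (hae e).trans (hlim (hns.comp hms.tendsto_atTop) hb e).symm
    refine ⟨ms, tendsto_iff_dist_tendsto_zero.2 (squeeze_zero (fun _ => dist_nonneg)
      (fun k => hπ _ σ) (tendsto_iff_dist_tendsto_zero.1 ?_))⟩
    have hcont : Continuous fun x : Fin m → ι → ℝ => fun i => x (σ i) := by fun_prop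
    have := (hcont.tendsto b).comp hb
    rwa [show (fun i => b (σ i)) = a from funext hσ] at this
  exact ⟨π, fun i j => ⟨a i j, tendsto_pi_nhds.1 (tendsto_pi_nhds.1 hconv i) j⟩⟩

end Relabel

/-! ### Convergence of symmetric statistics of the clusters -/

section Statistics

variable {L : FirstOrder.Language.{u, v}}

theorem FinStruct.abs_sum_sub_le (A : FinStruct L) {m : ℕ} {K : Fin m → Set A.carrier}
    (hK : ∀ i j, i ≠ j → Disjoint (K i) (K j)) {g T : A.carrier → ℝ} {s : Fin m → ℝ}
    {l σ τ : ℝ} (hτ : 0 ≤ τ) (hg : ∀ w, 0 ≤ g w) (hT : ∀ w, T w ∈ Set.Icc (0 : ℝ) 1)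
    (hs : ∀ i, s i ∈ Set.Icc (0 : ℝ) 1) (hgK : ∀ i, ∀ w ∈ K i, g w = 1)
    (hTK : ∀ i, ∀ w ∈ K i, |T w - s i| ≤ τ) (hKm : ∀ i, |A.meas (K i) - l| ≤ σ) :
    |∑ w, A.weight w * (g w * T w) - l * ∑ i, s i| ≤
      (∑ w, A.weight w * g w - m * l) + m * (2 * σ + τ) := by
  classical
  have hpt : ∀ w, |g w * T w - ∑ i, (if w ∈ K i then s i else 0)| ≤
      g w - ∑ i, (if w ∈ K i then (1 : ℝ) else 0) * (1 - τ) := by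
    intro w
    by_cases hw : ∃ i, w ∈ K i
    · obtain ⟨i, hi⟩ := hw
      have hne : ∀ j, j ≠ i → w ∉ K j := fun j hj hwj =>
        Set.disjoint_left.1 (hK j i hj) hwj hi
      rw [Finset.sum_eq_single i (fun j _ hj => if_neg (hne j hj)) (by simp),
        Finset.sum_eq_single i (fun j _ hj => by rw [if_neg (hne j hj), zero_mul]) (by simp),
        if_pos hi, if_pos hi, hgK i w hi, one_mul]
      linarith [hTK i w hi]
    · push Not at hw
      rw [Finset.sum_eq_zero fun i _ => if_neg (hw i),
        Finset.sum_eq_zero fun i _ => by rw [if_neg (hw i), zero_mul], sub_zero, sub_zero,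
        abs_of_nonneg (mul_nonneg (hg w) (hT w).1)]
      exact mul_le_of_le_one_right (hg w) (hT w).2
  have hswap : ∀ c : Fin m → ℝ, ∑ w, A.weight w * ∑ i, (if w ∈ K i then c i else 0) =
      ∑ i, A.meas (K i) * c i := by
    intro c
    simp only [meas_eq_sum_ite, Finset.mul_sum, Finset.sum_mul]
    rw [Finset.sum_comm]
    refine Finset.sum_congr rfl fun i _ => Finset.sum_congr rfl fun w _ => ?_
    split_ifs <;> simp
  have h₁ : |∑ w, A.weight w * (g w * T w) - ∑ i, A.meas (K i) * s i| ≤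
      ∑ w, A.weight w * g w - ∑ i, A.meas (K i) * (1 - τ) := by
    rw [← hswap, ← hswap, ← Finset.sum_sub_distrib, ← Finset.sum_sub_distrib]
    refine (Finset.abs_sum_le_sum_abs _ _).trans (Finset.sum_le_sum fun w _ => ?_)
    rw [← mul_sub, ← mul_sub, abs_mul, abs_of_nonneg (A.weight_nonneg w)]
    refine mul_le_mul_of_nonneg_left ((hpt w).trans_eq ?_) (A.weight_nonneg w)
    congr 1
    refine Finset.sum_congr rfl fun i _ => ?_
    split_ifs <;> simp
  have h₂ : |∑ i, A.meas (K i) * s i - l * ∑ i, s i| ≤ m * σ := by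
    rw [Finset.mul_sum, ← Finset.sum_sub_distrib]
    refine (Finset.abs_sum_le_sum_abs _ _).trans ?_
    refine (Finset.sum_le_card_nsmul _ _ σ fun i _ => ?_).trans_eq (by simp)
    rw [← sub_mul, abs_mul, abs_of_nonneg (hs i).1]
    exact (mul_le_of_le_one_right (abs_nonneg _) (hs i).2).trans (hKm i)
  have h₃ : m * (l - σ - τ) ≤ ∑ i, A.meas (K i) * (1 - τ) := by
    have := Finset.card_nsmul_le_sum Finset.univ (fun i => A.meas (K i) * (1 - τ)) (l - σ - τ)
      fun i _ => by
        nlinarith [(abs_le.1 (hKm i)).1, A.meas_le_one (K i), A.meas_nonneg (K i)]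
    simpa using this
  have h₄ := abs_sub_le (∑ w, A.weight w * (g w * T w)) (∑ i, A.meas (K i) * s i)
    (l * ∑ i, s i)
  linarith

variable [L.IsRelational] [Finite (Σ n, L.Relations (n + 2))]

theorem LocalConvergent.tendsto_sum_ball_continuous {A : ℕ → FinStruct L}
    (hA : LocalConvergent A) (d : ℕ) (f : C(ℝ, ℝ)) {p : ℕ}
    {φ : (L.sum markLang).Formula (Fin p)} (hφ : IsLocal φ) :
    ∃ l : ℝ, Tendsto (fun n => ∑ w, (A n).weight w *
      (f ((A n).ballMeas d w) * ((A n).mark (nbhd L d {w})).stonePairing φ)) atTop (𝓝 l) := by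
  let Λ : ℕ → C(ℝ, ℝ) →ₗ[ℝ] ℝ := fun n =>
    { toFun := fun f => ∑ w, (A n).weight w *
        (f ((A n).ballMeas d w) * ((A n).mark (nbhd L d {w})).stonePairing φ)
      map_add' := fun f g => by
        rw [← Finset.sum_add_distrib]
        refine Finset.sum_congr rfl fun w _ => ?_
        rw [ContinuousMap.add_apply]
        ring
      map_smul' := fun c f => by
        rw [RingHom.id_apply, smul_eq_mul, Finset.mul_sum]
        refine Finset.sum_congr rfl fun w _ => ?_
        rw [ContinuousMap.smul_apply, smul_eq_mul]
        ring }
  refine exists_tendsto_of_moments (Λ := Λ) (fun n f c hc => ?_)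
    (fun k => hA.tendsto_sum_ball d k hφ) f
  refine (Finset.abs_sum_le_sum_abs _ _).trans ?_
  rw [← one_mul c, ← (A n).weight_sum, Finset.sum_mul]
  refine Finset.sum_le_sum fun w _ => ?_
  rw [abs_mul, abs_mul, abs_of_nonneg ((A n).weight_nonneg w),
    abs_of_nonneg (FinStruct.stonePairing_nonneg _ φ)]
  refine mul_le_mul_of_nonneg_left ?_ ((A n).weight_nonneg w)
  exact (mul_le_of_le_one_right (abs_nonneg _) (FinStruct.stonePairing_le_one _ φ)).trans
    (hc _ ⟨(A n).ballMeas_nonneg d w, (A n).ballMeas_le_one d w⟩)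

theorem tendsto_sum_stonePairing_mark {A : ℕ → FinStruct L} (hA : LocalConvergent A)
    {P : ProbabilityMeasure ℝ} (hP : IsSpectrum A P) {l : ℝ} (hl : 0 < l) {m : ℕ}
    (hm : m * l = (P : Measure ℝ).real {l}) {C : Fin m → ∀ n, Set (A n).carrier}
    (hC : ∀ i, GlobularLike A (C i) l) (hdisj : ∀ i j, i ≠ j → ∀ n, Disjoint (C i n) (C j n))
    {p : ℕ} {φ : (L.sum markLang).Formula (Fin p)} (hφ : IsLocal φ) :
    ∃ c, Tendsto (fun n => ∑ i, ((A n).mark (C i n)).stonePairing φ) atTop (𝓝 c) := by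
  obtain ⟨r, hr⟩ := id hφ
  refine exists_tendsto_of_approx fun ε hε => ?_
  set η := l * ε / 4 with hη
  have hη0 : 0 < η := by positivity
  obtain ⟨ε₁, hε₁, hbump⟩ := exists_integral_bump_lt P l hη0
  set c : ℝ := m * (4 + 2 * p) + 1 with hc
  have hc0 : 0 < c := by positivity
  set η' := min (ε₁ / 2) (η / c) with hη'
  have hη'0 : 0 < η' := lt_min (by positivity) (by positivity)
  have hη'c : η' * c ≤ η := (le_div_iff₀ hc0).1 (min_le_right _ _)
  have hη'1 : η' ≤ ε₁ / 2 := min_le_left _ _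
  choose d₀ hd₀ using fun i => (hC i).exists_centres hη'0
  obtain ⟨d, hd, hdle⟩ := ((hP.eventually (bump l ε₁) hη0).and
    (eventually_ge_atTop (Finset.univ.sup d₀ + r))).exists
  obtain ⟨v, hv⟩ := hA.tendsto_sum_ball_continuous d (bump l ε₁).toContinuousMap hφ
  refine ⟨_, l⁻¹ * v, hv.const_mul l⁻¹, ?_⟩
  have hev := (hd.and (eventually_all.2 fun i => hd₀ i d)).and
    ((eventually_all.2 fun i => (hC i).limit.eventually_abs_sub_lt hη'0).and
      (eventually_all.2 fun i => (hC i).boundary.eventually_lt r hη'0))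
  filter_upwards [hev] with n ⟨⟨hsum, hcent⟩, hlim, hbd⟩
  choose K hKC hKm hK using hcent
  have hd₀d : ∀ i, d₀ i + r ≤ d := fun i =>
    (Nat.add_le_add_right (Finset.le_sup (Finset.mem_univ i)) r).trans hdle
  have hest := (A n).abs_sum_sub_le (K := K) (l := l) (σ := 2 * η') (τ := p * (2 * η'))
    (g := fun w => bump l ε₁ ((A n).ballMeas d w))
    (T := fun w => ((A n).mark (nbhd L d {w})).stonePairing φ)
    (s := fun i => ((A n).mark (C i n)).stonePairing φ)
    (fun i j hij => (hdisj i j hij n).mono (hKC i) (hKC j)) (by positivity)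
    (fun w => bump_nonneg _ _ _)
    (fun w => ⟨FinStruct.stonePairing_nonneg _ φ, FinStruct.stonePairing_le_one _ φ⟩)
    (fun i => ⟨FinStruct.stonePairing_nonneg _ φ, FinStruct.stonePairing_le_one _ φ⟩)
    (fun i w hw => by
      obtain ⟨hwC, hwm⟩ := hK i w hw
      refine bump_eq_one hε₁ ?_
      have h₁ := (A n).ballMeas_mono ((Nat.le_add_right _ r).trans (hd₀d i)) w
      have h₂ : (A n).ballMeas d w ≤ _ := (A n).meas_mono hwC
      have h₃ := abs_lt.1 (hlim i)
      rw [abs_le]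
      constructor <;> linarith)
    (fun i w hw => by
      obtain ⟨hwC, hwm⟩ := hK i w hw
      have hB : (A n).meas (nbhd L r (outerBoundary L (C i n)) ∪ (C i n \ nbhd L (d₀ i) {w})) ≤
          2 * η' := by
        refine ((A n).meas_union_le _ _).trans ?_
        rw [(A n).meas_diff ((nbhd_mono_radius ((Nat.le_add_right _ r).trans (hd₀d i)) _).trans
          hwC)]
        rw [FinStruct.ballMeas] at hwm
        linarith [hbd i]
      refine le_trans ((A n).abs_stonePairing_mark_sub_le hr
        (B := nbhd L r (outerBoundary L (C i n)) ∪ (C i n \ nbhd L (d₀ i) {w})) ?_ ?_)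
        (mul_le_mul_of_nonneg_left hB (Nat.cast_nonneg p))
      · rw [Set.sdiff_eq_empty.2 hwC]
        rintro y ⟨z, hz, -⟩
        exact absurd hz (Set.notMem_empty z)
      · intro y hy
        obtain ⟨z, ⟨hzC, hzw⟩, hyz⟩ := mem_nbhd_iff.1 hy
        by_cases hyb : y ∈ nbhd L r (outerBoundary L (C i n))
        · exact Or.inl hyb
        · refine Or.inr ⟨mem_of_mem_nbhd hzC hyb hyz, fun hyw => hzw ?_⟩
          exact nbhd_mono_radius (hd₀d i) _ (mem_nbhd_trans hyw (mem_nbhd_singleton_comm.1 hyz)))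
    (fun i => by
      have h₁ := abs_lt.1 (hlim i)
      have h₂ := hKm i
      have h₃ := (A n).meas_mono (hKC i)
      rw [abs_le]
      constructor <;> linarith)
  have h₁ : ∑ w, (A n).weight w * bump l ε₁ ((A n).ballMeas d w) - m * l ≤ 2 * η := by
    linarith [(abs_lt.1 hsum).2]
  have h₂ : m * (2 * (2 * η') + p * (2 * η')) ≤ η := by
    refine le_trans ?_ hη'c
    rw [hc]
    nlinarith
  have h₃ := hest.trans (add_le_add h₁ h₂)
  set I := ∑ w, (A n).weight w * (bump l ε₁ ((A n).ballMeas d w) *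
    ((A n).mark (nbhd L d {w})).stonePairing φ) with hI
  change |∑ i, ((A n).mark (C i n)).stonePairing φ - l⁻¹ * I| ≤ ε
  set u := ∑ i, ((A n).mark (C i n)).stonePairing φ with hu
  have h₄ : u - l⁻¹ * I = -(l⁻¹ * (I - l * u)) := by
    field_simp
    ring
  rw [h₄, abs_neg, abs_mul, abs_of_pos (inv_pos.2 hl), inv_mul_le_iff₀ hl]
  linarith

end Statistics

/-! ### The atoms of the spectrum -/

section Main

variable {L : FirstOrder.Language.{u, v}}

theorem countable_formula_marked [L.IsRelational] [Countable (Σ n, L.Relations n)] (p : ℕ) :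
    Countable ((L.sum markLang).Formula (Fin p)) := by
  have h₁ : ∀ n, Countable (MarkRel n) := fun n =>
    Function.Injective.countable (f := fun _ : MarkRel n => ()) fun a b _ => by
      cases a; cases b; rfl
  have h₂ : ∀ n, Countable (L.Relations n) := fun n =>
    Function.Injective.countable (f := fun R : L.Relations n => (⟨n, R⟩ : Σ n, L.Relations n))
      sigma_mk_injective
  have h₃ : ∀ n, Countable ((L.sum markLang).Relations n) := fun n =>
    inferInstanceAs (Countable (L.Relations n ⊕ MarkRel n))
  have h₄ : Countable (L.sum markLang).Symbols :=
    inferInstanceAs (Countable ((Σ n, (L.sum markLang).Functions n) ⊕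
      (Σ n, (L.sum markLang).Relations n)))
  infer_instance

theorem exists_formula_finsupp_prod [L.IsRelational]
    (e : (Σ p, {φ : L.Formula (Fin p) // IsLocal φ}) →₀ ℕ) :
    ∃ (q : ℕ) (χ : L.Formula (Fin q)), IsLocal χ ∧ ∀ A : FinStruct L,
      A.stonePairing χ = e.prod fun j k => A.stonePairing j.2.1 ^ k := by
  induction e using Finsupp.induction_linear with
  | zero => exact ⟨0, ⊤, isLocal_top, fun A => by simp [stonePairing_top]⟩
  | add f g hf hg =>
    obtain ⟨_, χ₁, h₁, h₁'⟩ := hf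
    obtain ⟨_, χ₂, h₂, h₂'⟩ := hg
    obtain ⟨χ, hχ, h⟩ := exists_formula_mul h₁ h₂
    refine ⟨_, χ, hχ, fun A => ?_⟩
    rw [h, h₁', h₂', Finsupp.prod_add_index' (fun _ => pow_zero _) (fun _ _ _ => pow_add _ _ _)]
  | single j k =>
    have : ∃ (q : ℕ) (χ : L.Formula (Fin q)), IsLocal χ ∧ ∀ A : FinStruct L,
        A.stonePairing χ = A.stonePairing j.2.1 ^ k := by
      induction k with
      | zero => exact ⟨0, ⊤, isLocal_top, fun A => by simp [stonePairing_top]⟩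
      | succ k ih =>
        obtain ⟨_, χ, h, h'⟩ := ih
        obtain ⟨χ', hχ', h''⟩ := exists_formula_mul h j.2.2
        exact ⟨_, χ', hχ', fun A => by rw [h'', h', pow_succ]⟩
    simpa [Finsupp.prod_single_index] using this

theorem exists_isGlobular [L.IsRelational] [Countable (Σ n, L.Relations n)]
    [Finite (Σ n, L.Relations (n + 2))] {A : ℕ → FinStruct L} (hA : LocalConvergent A)
    {P : ProbabilityMeasure ℝ} (hP : IsSpectrum A P) {l : ℝ} (hl : 0 < l) {m : ℕ}
    (hm : m * l = (P : Measure ℝ).real {l}) {C : Fin m → ∀ n, Set (A n).carrier}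
    (hC : ∀ i, GlobularLike A (C i) l) (hdisj : ∀ i j, i ≠ j → ∀ n, Disjoint (C i n) (C j n)) :
    ∃ G : Fin m → ∀ n, Set (A n).carrier,
      (∀ i, IsGlobular A (G i) ∧ HasLimitMeasure A (G i) l) ∧
      ∀ i j, i ≠ j → ∀ n, Disjoint (G i n) (G j n) := by
  have := fun p => countable_formula_marked (L := L) p
  obtain ⟨π, hπ⟩ := exists_relabelling
    (ι := Σ p, {φ : (L.sum markLang).Formula (Fin p) // IsLocal φ})
    (s := fun n i j => ((A n).mark (C i n)).stonePairing j.2.1)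
    (fun n i j => ⟨FinStruct.stonePairing_nonneg _ _, FinStruct.stonePairing_le_one _ _⟩)
    (fun e => by
      obtain ⟨q, χ, hχ, h⟩ := exists_formula_finsupp_prod e
      obtain ⟨c, hc⟩ := tendsto_sum_stonePairing_mark hA hP hl hm hC hdisj hχ
      refine ⟨c, hc.congr fun n => ?_⟩
      simp only [h]
      rfl)
  have hG : ∀ i, GlobularLike A (fun n => C (π n i) n) l := fun i =>
    GlobularLike.select hC fun n => π n i
  refine ⟨fun i n => C (π n i) n, fun i => ⟨⟨⟨fun p φ hφ => hπ i ⟨p, φ, hφ⟩, (hG i).boundary⟩,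
    (hG i).not_negligible hl, (hG i).nonDispersive hl⟩, (hG i).limit⟩, fun i j hij n => ?_⟩
  exact hdisj _ _ (fun h => hij ((π n).injective h)) n

end Main

end StructLim

end

theorem mainTheorem9 (L : FirstOrder.Language.{u, v}) [L.IsRelational]
    [Countable (Σ n, L.Relations n)] [Finite (Σ n, L.Relations (n + 2))]
    (A : ℕ → StructLim.FinStruct L) (hA : StructLim.LocalConvergent A) :
    (∃ P : ProbabilityMeasure ℝ, StructLim.IsSpectrum A P) ∧
    ∀ P : ProbabilityMeasure ℝ, StructLim.IsSpectrum A P →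
      ∀ x ∈ StructLim.atoms P, 0 < x →
        ∃ m : ℕ, 0 < m ∧ StructLim.massAt P x / x = m ∧
          (∃ G : Fin m → ∀ n, Set (A n).carrier,
            (∀ i, StructLim.IsGlobular A (G i) ∧ StructLim.HasLimitMeasure A (G i) x) ∧
            ∀ i j, i ≠ j → ∀ n, Disjoint (G i n) (G j n)) ∧
          (∀ (k : ℕ) (G : Fin k → ∀ n, Set (A n).carrier),
            (∀ i, StructLim.IsGlobular A (G i) ∧ StructLim.HasLimitMeasure A (G i) x) →
            (∀ i j, i ≠ j → StructLim.Negligible A (fun n => G i n ∩ G j n)) →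
            k ≤ m) := by
  refine ⟨StructLim.exists_isSpectrum hA, fun P hP x hx hx0 => ?_⟩
  have hp := StructLim.massAt_pos hx
  rw [StructLim.massAt_eq] at hp ⊢
  set p := (P : Measure ℝ).real {x} with hpdef
  have hlt : (⌈p / x⌉₊ : ℝ) * x < p + x := by
    have := mul_lt_mul_of_pos_right (Nat.ceil_lt_add_one (div_pos hp hx0).le) hx0
    rwa [add_mul, div_mul_cancel₀ _ hx0.ne', one_mul] at this
  obtain ⟨C, hC, hdisj⟩ := hP.exists_globularLike hx0 hlt
  have hle := StructLim.mul_le_of_globularLike hP hC fun i j hij d => by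
    have hempty : ∀ n, StructLim.nbhd L d (C i n ∩ C j n) = ∅ := fun n => by
      rw [Set.disjoint_iff_inter_eq_empty.1 (hdisj i j hij n)]
      simp [StructLim.nbhd]
    simp [hempty]
  have hge : p ≤ ⌈p / x⌉₊ * x := (div_le_iff₀ hx0).1 (Nat.le_ceil _)
  have heq : (⌈p / x⌉₊ : ℝ) * x = p := le_antisymm hle hge
  refine ⟨⌈p / x⌉₊, Nat.ceil_pos.2 (div_pos hp hx0), ?_,
    StructLim.exists_isGlobular hA hP hx0 heq hC hdisj, fun k G hG hint => ?_⟩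
  · rw [div_eq_iff hx0.ne', heq]
  · have h := StructLim.mul_le_of_globularLike hP
      (fun i => (hG i).1.globularLike hx0 (hG i).2) hint
    rw [← hpdef, ← heq] at h
    exact_mod_cast le_of_mul_le_mul_right h hx0
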